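/- Theorem 2. The independent set reconfiguration problem under the 2-Jump model can be solved in polynomial time for split graphs. In detail: for independent sets $I, J$ of a finite simple graph $G$, write $I \leftrightarrow_2 J$ if $|I\setminus J| = |J\setminus I| = 1$ and the vertex of $I\setminus J$ and the vertex of $J\setminus I$ are at distance at most $2$ in $G$; let $\rightsquigarrow_2$ be the reflexive transitive closure of $\leftrightarrow_2$ on the independent sets of $G$. A graph is split if its vertex set can be partitioned into a clique and an independent set (the partition is not part of the input, and the graph need not be connected). Then there are a deterministic random access machine program (registers and arrays of natural numbers; the elementary operations, including addition and truncated subtraction but not multiplication, each take one unit of time) and a polynomial $f$ such that, for every $n$, every split graph $G$ on the vertices $0,\dots,n-1$ and all independent sets $I_s, I_t$ of $G$, the program, started on the adjacency matrix of $G$ and the characteristic vectors of $I_s$ and $I_t$, halts after at most $f(n)$ units of time and outputs $1$ if $I_s \rightsquigarrow_2 I_t$ and $0$ otherwise. -/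

import Mathlib

/-! ### Independent set reconfiguration under the `k`-Jump model -/

/-- A graph is a *split graph* if its vertices can be partitioned into a clique `A` and an
independent set (the complement of `A`). -/
def SimpleGraph.IsSplit {V : Type*} (G : SimpleGraph V) : Prop :=
  ∃ A : Set V, G.IsClique A ∧ G.IsIndepSet Aᶜ

/-- One step of the `k`-Jump model: `I` and `J` are independent sets of `G`, and `J` arises from
`I` by moving exactly one token, to a vertex within distance `k` of its previous position.
`SimpleGraph.edist` is the graph distance with value `⊤` between different components. -/
def JumpStep {V : Type*} [DecidableEq V] (G : SimpleGraph V) (k : ℕ) (I J : Finset V) : Prop :=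
  G.IsIndepSet (I : Set V) ∧ G.IsIndepSet (J : Set V) ∧
    (I \ J).card = 1 ∧ (J \ I).card = 1 ∧
    ∀ u ∈ I \ J, ∀ v ∈ J \ I, G.edist u v ≤ (k : ℕ∞)

/-- `J` can be obtained from `I` by finitely many (possibly zero) steps of the `k`-Jump model. -/
def Reconfigurable {V : Type*} [DecidableEq V] (G : SimpleGraph V) (k : ℕ) :
    Finset V → Finset V → Prop :=
  Relation.ReflTransGen (JumpStep G k)

/-! ### Random access machines with a step count

A program works on finitely many registers and finitely many unbounded arrays, all of whose cells
hold natural numbers.  The elementary operations are constants, reading a register, reading an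
array cell at a computed index, addition, truncated subtraction, assignment, and testing for
zero, and each of them costs one unit of time.  There is no multiplication, so one operation at
most doubles the largest number present: after `t` units of time, numbers have at most `t` bits
more than at the start (up to a constant of the program), and polynomial time on this machine is
polynomial time in the usual sense. -/

namespace RAM

/-- The contents of the registers and of the arrays. -/
structure State where
  reg : ℕ → ℕ
  arr : ℕ → ℕ → ℕ

/-- Expressions. Registers and arrays are named by numerals that are fixed in the program, while
`arr a e` reads array number `a` at an index computed at run time. -/
inductive Expr where
  | const (c : ℕ)
  | reg (x : ℕ)
  | arr (a : ℕ) (e : Expr)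
  | add (e f : Expr)
  | sub (e f : Expr)

/-- The value of an expression. -/
def Expr.eval (s : State) : Expr → ℕ
  | .const c => c
  | .reg x => s.reg x
  | .arr a e => s.arr a (e.eval s)
  | .add e f => e.eval s + f.eval s
  | .sub e f => e.eval s - f.eval s

/-- The time for evaluating an expression: one unit for each operation in it. -/
def Expr.cost : Expr → ℕ
  | .const _ => 1
  | .reg _ => 1
  | .arr _ e => e.cost + 1
  | .add e f => e.cost + f.cost + 1
  | .sub e f => e.cost + f.cost + 1

/-- Programs. A condition counts as true if its value is nonzero. -/
inductive Program where
  | skip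
  | assign (x : ℕ) (e : Expr)
  | store (a : ℕ) (i e : Expr)
  | seq (p q : Program)
  | cond (e : Expr) (p q : Program)
  | loop (e : Expr) (p : Program)

/-- The state after writing `v` into register `x`. -/
def State.setReg (s : State) (x v : ℕ) : State :=
  { s with reg := Function.update s.reg x v }

/-- The state after writing `v` into cell `i` of array `a`. -/
def State.setArr (s : State) (a i v : ℕ) : State :=
  { s with arr := Function.update s.arr a (Function.update (s.arr a) i v) }

/-- `Runs p s t s'`: started in state `s`, the program `p` halts in state `s'` after exactly
`t` units of time. -/
inductive Runs : Program → State → ℕ → State → Prop where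
  | skip (s : State) : Runs .skip s 1 s
  | assign (s : State) (x : ℕ) (e : Expr) :
      Runs (.assign x e) s (e.cost + 1) (s.setReg x (e.eval s))
  | store (s : State) (a : ℕ) (i e : Expr) :
      Runs (.store a i e) s (i.cost + e.cost + 1) (s.setArr a (i.eval s) (e.eval s))
  | seq {p q : Program} {s s' s'' : State} {t t' : ℕ} :
      Runs p s t s' → Runs q s' t' s'' → Runs (.seq p q) s (t + t') s''
  | cond_true {e : Expr} {p q : Program} {s s' : State} {t : ℕ} :
      e.eval s ≠ 0 → Runs p s t s' → Runs (.cond e p q) s (e.cost + 1 + t) s'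
  | cond_false {e : Expr} {p q : Program} {s s' : State} {t : ℕ} :
      e.eval s = 0 → Runs q s t s' → Runs (.cond e p q) s (e.cost + 1 + t) s'
  | loop_true {e : Expr} {p : Program} {s s' s'' : State} {t t' : ℕ} :
      e.eval s ≠ 0 → Runs p s t s' → Runs (.loop e p) s' t' s'' →
        Runs (.loop e p) s (e.cost + 1 + t + t') s''
  | loop_false {e : Expr} {p : Program} {s : State} :
      e.eval s = 0 → Runs (.loop e p) s (e.cost + 1) s

/-- The machine is deterministic. -/
theorem Runs.deterministic {p : Program} {s s₁ s₂ : State} {t₁ t₂ : ℕ}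
    (h₁ : Runs p s t₁ s₁) (h₂ : Runs p s t₂ s₂) : t₁ = t₂ ∧ s₁ = s₂ := by
  induction h₁ generalizing t₂ s₂ with
  | skip s => cases h₂; exact ⟨rfl, rfl⟩
  | assign s x e => cases h₂; exact ⟨rfl, rfl⟩
  | store s a i e => cases h₂; exact ⟨rfl, rfl⟩
  | seq _ _ ih ih' =>
    cases h₂ with
    | seq a b =>
      obtain ⟨rfl, rfl⟩ := ih a
      obtain ⟨rfl, rfl⟩ := ih' b
      exact ⟨rfl, rfl⟩
  | cond_true h _ ih =>
    cases h₂ with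
    | cond_true _ a => obtain ⟨rfl, rfl⟩ := ih a; exact ⟨rfl, rfl⟩
    | cond_false h' _ => exact absurd h' h
  | cond_false h _ ih =>
    cases h₂ with
    | cond_true h' _ => exact absurd h h'
    | cond_false _ a => obtain ⟨rfl, rfl⟩ := ih a; exact ⟨rfl, rfl⟩
  | loop_true h _ _ ih ih' =>
    cases h₂ with
    | loop_true _ a b =>
      obtain ⟨rfl, rfl⟩ := ih a
      obtain ⟨rfl, rfl⟩ := ih' b
      exact ⟨rfl, rfl⟩
    | loop_false h' => exact absurd h' h
  | loop_false h =>
    cases h₂ with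
    | loop_true h' _ _ => exact absurd h h'
    | loop_false _ => exact ⟨rfl, rfl⟩

end RAM

/-! ### Instances as inputs of the machine -/

open Classical in
/-- The initial state for the instance `(G, Is, It)` on the vertices `0, …, n - 1`: register `0`
holds `n`, array `0` holds the adjacency matrix of `G` row by row (the entry for `u, v` in cell
`u * n + v`), arrays `1` and `2` hold the characteristic vectors of `Is` and `It`; every other
register and cell is `0`. -/
noncomputable def instanceInput {n : ℕ} (G : SimpleGraph (Fin n)) (Is It : Finset (Fin n)) :
    RAM.State where
  reg x := if x = 0 then n else 0
  arr a i :=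
    if a = 0 ∧ ∃ u v : Fin n, i = u.val * n + v.val ∧ G.Adj u v then 1
    else if a = 1 ∧ ∃ u ∈ Is, i = u.val then 1
    else if a = 2 ∧ ∃ u ∈ It, i = u.val then 1
    else 0

/-! The proof has a combinatorial half, a criterion for reconfigurability in split graphs, and an
algorithmic half, a program that evaluates the criterion.

Let `A` be a clique whose complement is independent.  An independent set has at most one vertex in
`A`.  Isolated vertices outside `A` (`frozen`) never lose or gain a token; the other vertices
outside `A` are called `movable`.  Let `crossGraph G A` consist of the edges that are not inside
`A`.  A jump of length two between vertices outside `A` stays in a component of `crossGraph G A`,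
and within a component such jumps can realize every distribution of the tokens
(`reconfigurable_slide`).  So the token sets that avoid `A` fall into classes given by the number of
tokens in each component.  A vertex `a` of `A` has distance at most two from all movable vertices
and from `A`; hence all independent sets with a token on `a` and the same frozen tokens can be
transformed into each other (`reconfigurable_of_mem`).  A class of token sets avoiding `A` is joined
to the class of `a` iff, in the component of `a`, all but at most one of the tokens fit on
non-neighbours of `a` (`Enters`), and the classes of `a` and `b` are joined, directly or through one
class avoiding `A`, iff a numerical condition on their numbers of neighbours outside `A` holds
(`Linked`).  Reconfigurability is therefore connectivity in a graph with polynomially many vertices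
(`reconfigurable_iff_criterion`).  The necessity of the criterion amounts to its being transitive
and valid for single jumps; its sufficiency is the construction of the corresponding sequences.

The partition is not part of the input, but a largest possible `A` consists of the vertices whose
degree exceeds a threshold `d` and of at most one more vertex `v` (`exists_isSplitSet_degSet`), so
that it can be found by trying all pairs `(d, v)`.

The program is built from terms with bounded sums (`RAM.CountTerm`), which express quantifiers and
cardinalities, and from commands that tabulate such terms (`RAM.Command`).  Both are compiled to the
machine once and for all, with polynomial time bounds (`CountTerm.exists_runs_compile`,
`Command.exists_runs_compile`); what remains is to write down the criterion as a term that refers to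
two transitive closures computed in advance (`RAM.Command.closure`). -/

/-! ### Counting terms and their compilation -/

namespace RAM

/-- Terms built from constants, registers and array cells by addition, truncated subtraction and
sums `∑ i < n`, where `n` is the content of register `0`.  The summation variable is a register:
`sum x t` is the sum of the values of `t` when register `x` holds `0, …, n - 1`. -/
inductive CountTerm where
  | const (c : ℕ)
  | reg (x : ℕ)
  | arr (a : ℕ) (t : CountTerm)
  | add (t u : CountTerm)
  | sub (t u : CountTerm)
  | sum (x : ℕ) (t : CountTerm)

namespace CountTerm

/-- The value of a term. -/
def eval : CountTerm → State → ℕ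
  | const c, _ => c
  | reg x, s => s.reg x
  | arr a t, s => s.arr a (t.eval s)
  | add t u, s => t.eval s + u.eval s
  | sub t u, s => t.eval s - u.eval s
  | sum x t, s => ∑ i ∈ Finset.range (s.reg 0), t.eval (s.setReg x i)

/-- All registers of the term are below `k`, and register `0` is not a summation variable. -/
def Bounded (k : ℕ) : CountTerm → Prop
  | const _ => True
  | reg x => x < k
  | arr _ t => t.Bounded k
  | add t u => t.Bounded k ∧ u.Bounded k
  | sub t u => t.Bounded k ∧ u.Bounded k
  | sum x t => x ≠ 0 ∧ x < k ∧ t.Bounded k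

/-- A program that leaves the value of the term in register `k`, works in the registers from `k`
on, and restores the summation variables. -/
def compile : CountTerm → ℕ → Program
  | const c, k => .assign k (.const c)
  | reg x, k => .assign k (.reg x)
  | arr a t, k => .seq (t.compile k) (.assign k (.arr a (.reg k)))
  | add t u, k => .seq (t.compile k)
      (.seq (u.compile (k + 1)) (.assign k (.add (.reg k) (.reg (k + 1)))))
  | sub t u, k => .seq (t.compile k)
      (.seq (u.compile (k + 1)) (.assign k (.sub (.reg k) (.reg (k + 1)))))
  | sum x t, k => .seq (.assign k (.const 0)) (.seq (.assign (k + 1) (.reg x))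
      (.seq (.assign x (.const 0))
        (.seq (.loop (.sub (.reg 0) (.reg x))
            (.seq (t.compile (k + 2)) (.seq (.assign k (.add (.reg k) (.reg (k + 2))))
              (.assign x (.add (.reg x) (.const 1))))))
          (.assign x (.reg (k + 1))))))

end CountTerm

@[simp] theorem State.setReg_arr (s : State) (x v : ℕ) : (s.setReg x v).arr = s.arr := rfl

@[simp] theorem State.setArr_reg (s : State) (a i v : ℕ) : (s.setArr a i v).reg = s.reg := rfl

@[simp] theorem State.setReg_reg (s : State) (x v y : ℕ) :
    (s.setReg x v).reg y = if y = x then v else s.reg y := by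
  simp [State.setReg, Function.update_apply]

theorem State.setArr_arr (s : State) (a i v b j : ℕ) :
    (s.setArr a i v).arr b j = if b = a ∧ j = i then v else s.arr b j := by
  by_cases h : b = a
  · subst h
    simp [State.setArr, Function.update_apply]
  · simp [State.setArr, h]

/-- Two states agree up to the scratch registers, those from `k` on. -/
def State.Agree (k : ℕ) (s s' : State) : Prop :=
  s'.arr = s.arr ∧ ∀ j < k, s'.reg j = s.reg j

theorem State.Agree.refl (k : ℕ) (s : State) : s.Agree k s := ⟨rfl, fun _ _ => rfl⟩

theorem State.Agree.trans {k : ℕ} {s₁ s₂ s₃ : State} (h : s₁.Agree k s₂) (h' : s₂.Agree k s₃) :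
    s₁.Agree k s₃ :=
  ⟨h'.1.trans h.1, fun j hj => (h'.2 j hj).trans (h.2 j hj)⟩

theorem State.Agree.setReg {k : ℕ} {s s' : State} (h : s.Agree k s') (x v : ℕ) :
    (s.setReg x v).Agree k (s'.setReg x v) :=
  ⟨h.1, fun j hj => by simp [h.2 j hj]⟩

theorem State.agree_setReg (k : ℕ) (s : State) (v : ℕ) : s.Agree k (s.setReg k v) :=
  ⟨rfl, fun j hj => by simp [hj.ne]⟩

theorem State.Agree.mono {k l : ℕ} {s s' : State} (h : s.Agree k s') (hl : l ≤ k) :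
    s.Agree l s' :=
  ⟨h.1, fun j hj => h.2 j (hj.trans_le hl)⟩

theorem CountTerm.eval_congr {k : ℕ} (hk : 0 < k) {t : CountTerm} (ht : t.Bounded k)
    {s s' : State} (h : s.Agree k s') : t.eval s' = t.eval s := by
  induction t generalizing s s' with
  | const c => rfl
  | reg x => exact h.2 x ht
  | arr a t ih => simp only [eval, ih ht h, h.1]
  | add t u iht ihu => simp only [eval, iht ht.1 h, ihu ht.2 h]
  | sub t u iht ihu => simp only [eval, iht ht.1 h, ihu ht.2 h]
  | sum x t ih =>
    simp only [eval, h.2 0 hk]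
    exact Finset.sum_congr rfl fun i _ => ih ht.2.2 (h.setReg x i)

theorem CountTerm.Bounded.mono {k l : ℕ} (hkl : k ≤ l) {t : CountTerm} (ht : t.Bounded k) :
    t.Bounded l := by
  induction t with
  | const c => trivial
  | reg x => exact lt_of_lt_of_le ht hkl
  | arr a t ih => exact ih ht
  | add t u iht ihu => exact ⟨iht ht.1, ihu ht.2⟩
  | sub t u iht ihu => exact ⟨iht ht.1, ihu ht.2⟩
  | sum x t ih => exact ⟨ht.1, ht.2.1.trans_le hkl, ih ht.2.2⟩

/-- The rule for loops that count register `x` up to the content `n` of register `0`. -/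
theorem exists_runs_loop {p : Program} {x n T : ℕ} (I : ℕ → State → Prop)
    (hI : ∀ i s, I i s → s.reg 0 = n ∧ s.reg x = i)
    (hp : ∀ i < n, ∀ s, I i s → ∃ t s', Runs p s t s' ∧ t ≤ T ∧ I (i + 1) s')
    {s : State} (hs : I 0 s) :
    ∃ t s', Runs (.loop (.sub (.reg 0) (.reg x)) p) s t s' ∧ t ≤ n * (T + 4) + 4 ∧ I n s' := by
  suffices H : ∀ m i s, i + m = n → I i s →
      ∃ t s', Runs (.loop (.sub (.reg 0) (.reg x)) p) s t s' ∧ t ≤ m * (T + 4) + 4 ∧ I n s' from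
    H n 0 s (by simp) hs
  intro m
  induction m with
  | zero =>
    intro i s hi hs
    obtain ⟨h0, hx⟩ := hI i s hs
    refine ⟨_, s, Runs.loop_false (by simp [Expr.eval]; omega), by simp [Expr.cost], ?_⟩
    rwa [show n = i by omega]
  | succ m ih =>
    intro i s hi hs
    obtain ⟨h0, hx⟩ := hI i s hs
    obtain ⟨t, s', hr, ht, hs'⟩ := hp i (by omega) s hs
    obtain ⟨t', s'', hr', ht', hs''⟩ := ih (i + 1) s' (by omega) hs'
    refine ⟨_, s'', Runs.loop_true (by simp [Expr.eval]; omega) hr hr', ?_, hs''⟩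
    simp only [Expr.cost]
    linarith [add_mul m 1 (T + 4)]

/-- Terms are evaluated in polynomial time. -/
theorem CountTerm.exists_runs_compile (t : CountTerm) (k : ℕ) (hk : 0 < k) (ht : t.Bounded k) :
    ∃ f : Polynomial ℕ, ∀ s : State, ∃ τ s', Runs (t.compile k) s τ s' ∧
      τ ≤ f.eval (s.reg 0) ∧ s.Agree k s' ∧ s'.reg k = t.eval s := by
  induction t generalizing k with
  | const c =>
    exact ⟨Polynomial.C 2, fun s => ⟨_, _, Runs.assign _ _ _, by simp [Expr.cost],
      State.agree_setReg _ _ _, by simp [eval, Expr.eval]⟩⟩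
  | reg x =>
    exact ⟨Polynomial.C 2, fun s => ⟨_, _, Runs.assign _ _ _, by simp [Expr.cost],
      State.agree_setReg _ _ _, by simp [eval, Expr.eval]⟩⟩
  | arr a t ih =>
    obtain ⟨f, hf⟩ := ih k hk ht
    refine ⟨f + Polynomial.C 3, fun s => ?_⟩
    obtain ⟨τ, s', hr, hτ, hs, hv⟩ := hf s
    exact ⟨_, _, hr.seq (Runs.assign _ _ _), by simp [Expr.cost, hτ],
      hs.trans (State.agree_setReg _ _ _), by simp [eval, Expr.eval, hv, hs.1]⟩
  | add t u iht ihu =>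
    obtain ⟨f, hf⟩ := iht k hk ht.1
    obtain ⟨g, hg⟩ := ihu (k + 1) (by omega) (ht.2.mono (by omega))
    refine ⟨f + g + Polynomial.C 4, fun s => ?_⟩
    obtain ⟨τ, s', hr, hτ, hs, hv⟩ := hf s
    obtain ⟨τ', s'', hr', hτ', hs', hv'⟩ := hg s'
    rw [hs.2 0 hk] at hτ'
    have hs'' := hs'.mono (Nat.le_succ k)
    refine ⟨_, _, hr.seq (hr'.seq (Runs.assign _ _ _)), ?_,
      (hs.trans hs'').trans (State.agree_setReg _ _ _), ?_⟩
    · simp only [Expr.cost, Polynomial.eval_add, Polynomial.eval_C]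
      omega
    · simp only [State.setReg_reg, if_true, Expr.eval, eval, hv']
      rw [hs'.2 k (by omega), hv, eval_congr hk ht.2 hs]
  | sub t u iht ihu =>
    obtain ⟨f, hf⟩ := iht k hk ht.1
    obtain ⟨g, hg⟩ := ihu (k + 1) (by omega) (ht.2.mono (by omega))
    refine ⟨f + g + Polynomial.C 4, fun s => ?_⟩
    obtain ⟨τ, s', hr, hτ, hs, hv⟩ := hf s
    obtain ⟨τ', s'', hr', hτ', hs', hv'⟩ := hg s'
    rw [hs.2 0 hk] at hτ'
    have hs'' := hs'.mono (Nat.le_succ k)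
    refine ⟨_, _, hr.seq (hr'.seq (Runs.assign _ _ _)), ?_,
      (hs.trans hs'').trans (State.agree_setReg _ _ _), ?_⟩
    · simp only [Expr.cost, Polynomial.eval_add, Polynomial.eval_C]
      omega
    · simp only [State.setReg_reg, if_true, Expr.eval, eval, hv']
      rw [hs'.2 k (by omega), hv, eval_congr hk ht.2 hs]
  | sum x t ih =>
    obtain ⟨hx0, hxk, ht⟩ := ht
    obtain ⟨f, hf⟩ := ih (k + 2) (by omega) (ht.mono (by omega))
    refine ⟨Polynomial.X * (f + Polynomial.C 12) + Polynomial.C 12, fun s => ?_⟩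
    set n := s.reg 0 with hn
    -- After `i` rounds, register `k` holds the sum of the first `i` values.
    let I : ℕ → State → Prop := fun i s' => s'.arr = s.arr ∧ (∀ j < k, j ≠ x → s'.reg j = s.reg j) ∧
      s'.reg x = i ∧ s'.reg (k + 1) = s.reg x ∧
      s'.reg k = ∑ j ∈ Finset.range i, t.eval (s.setReg x j)
    have hloop := exists_runs_loop (x := x) (n := n) (T := f.eval n + 8)
      (p := .seq (t.compile (k + 2)) (.seq (.assign k (.add (.reg k) (.reg (k + 2))))
              (.assign x (.add (.reg x) (.const 1))))) I
      (fun i s' h => ⟨h.2.1 0 hk hx0.symm, h.2.2.1⟩)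
      (by
        rintro i hi s₁ ⟨h1, h2, h3, h4, h5⟩
        obtain ⟨τ, s', hr, hτ, hs, hv⟩ := hf s₁
        have hagree : (s.setReg x i).Agree k s₁ := ⟨h1, fun j hj => by
          by_cases hjx : j = x
          · simp [hjx, h3]
          · simp [hjx, h2 j hj hjx]⟩
        refine ⟨_, _, hr.seq ((Runs.assign _ _ _).seq (Runs.assign _ _ _)), ?_, ?_, ?_, ?_, ?_, ?_⟩
        · rw [h2 0 hk hx0.symm, ← hn] at hτ
          simp only [Expr.cost]
          omega
        · simp [hs.1, h1]
        · intro j hj hjx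
          simp [hjx, hj.ne, hs.2 j (by omega), h2 j hj hjx]
        · simp [Expr.eval, hxk.ne, hs.2 x (by omega), h3]
        · have : k + 1 ≠ x := by omega
          simp [this, hs.2 (k + 1) (by omega), h4]
        · have : k ≠ x := by omega
          simp only [State.setReg_reg, this, if_false, if_true, Expr.eval, hv, hs.2 k (by omega), h5,
            Finset.sum_range_succ, eval_congr hk ht hagree])
      (s := ((s.setReg k 0).setReg (k + 1) (s.reg x)).setReg x 0)
      (by
        refine ⟨rfl, ?_, ?_, ?_, ?_⟩
        · intro j hj hjx
          have : j ≠ k + 1 := by omega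
          simp [hjx, hj.ne, this]
        · simp
        · have : k + 1 ≠ x := by omega
          simp [this]
        · have : k ≠ x := by omega
          simp [this])
    obtain ⟨τ, s', hr, hτ, h1, h2, h3, h4, h5⟩ := hloop
    refine ⟨_, _, (Runs.assign _ _ _).seq ((Runs.assign _ _ _).seq ((Runs.assign _ _ _).seq
      (Runs.seq (t := τ) (s' := s') ?_ (Runs.assign _ _ _)))), ?_, ⟨?_, ?_⟩, ?_⟩
    · convert hr using 2
      · simp [Expr.eval, hxk.ne]
      · rfl
    · simp only [Expr.cost, Polynomial.eval_add, Polynomial.eval_mul, Polynomial.eval_X,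
        Polynomial.eval_C]
      have : f.eval n + 8 + 4 = f.eval n + 12 := rfl
      rw [this] at hτ
      omega
    · simp [h1]
    · intro j hj
      by_cases hjx : j = x
      · simp [hjx, Expr.eval, h4]
      · simp [hjx, h2 j hj hjx]
    · have : k ≠ x := by omega
      simp [this, h5, eval, hn]

/-! ### Commands with counted loops -/

/-- Commands: storing the value of a term into an array cell, composition, and loops in which a
register runs through `0, …, n - 1`, where `n` is the content of register `0`. -/
inductive Command where
  | store (a : ℕ) (i t : CountTerm)
  | seq (c d : Command)
  | loop (x : ℕ) (c : Command)

namespace Command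

/-- The effect of a command. -/
def run : Command → State → State
  | store a i t, s => s.setArr a (i.eval s) (t.eval s)
  | seq c d, s => d.run (c.run s)
  | loop x c, s => (List.range (s.reg 0)).foldl (fun s' i => c.run (s'.setReg x i)) s

/-- All registers of the command are below `k`, and register `0` is not a loop variable. -/
def Bounded (k : ℕ) : Command → Prop
  | store _ i t => i.Bounded k ∧ t.Bounded k
  | seq c d => c.Bounded k ∧ d.Bounded k
  | loop x c => x ≠ 0 ∧ x < k ∧ c.Bounded k

/-- A program for the command, with the registers from `k` on as scratch space. -/
def compile : Command → ℕ → Program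
  | store a i t, k => .seq (i.compile k) (.seq (t.compile (k + 1))
      (.store a (.reg k) (.reg (k + 1))))
  | seq c d, k => .seq (c.compile k) (d.compile k)
  | loop x c, k => .seq (.assign k (.const 0))
      (.loop (.sub (.reg 0) (.reg k))
        (.seq (.assign x (.reg k)) (.seq (c.compile (k + 1))
          (.assign k (.add (.reg k) (.const 1))))))

theorem Bounded.mono {k l : ℕ} (hkl : k ≤ l) {c : Command} (hc : c.Bounded k) :
    c.Bounded l := by
  induction c with
  | store a i t => exact ⟨hc.1.mono hkl, hc.2.mono hkl⟩
  | seq c d ihc ihd => exact ⟨ihc hc.1, ihd hc.2⟩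
  | loop x c ih => exact ⟨hc.1, hc.2.1.trans_le hkl, ih hc.2.2⟩

theorem run_reg_zero {k : ℕ} {c : Command} (hc : c.Bounded k) (s : State) :
    (c.run s).reg 0 = s.reg 0 := by
  induction c generalizing s with
  | store a i t => rfl
  | seq c d ihc ihd => simp only [run, ihd hc.2, ihc hc.1]
  | loop x c ih =>
    simp only [run]
    generalize List.range (s.reg 0) = l
    induction l generalizing s with
    | nil => rfl
    | cons i l ihl =>
      rw [List.foldl_cons, ihl, ih hc.2.2]
      simp [hc.1.symm]

/-- Commands are executed in polynomial time.  The registers from `K` to `k` are neither used by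
the command nor by its scratch space; loops keep their counters there. -/
theorem exists_runs_compile (c : Command) {K : ℕ} (hK : 0 < K) (hc : c.Bounded K) (k : ℕ)
    (hk : K ≤ k) :
    ∃ f : Polynomial ℕ, ∀ s s₀ : State, s₀.Agree K s → ∃ τ s', Runs (c.compile k) s τ s' ∧
      τ ≤ f.eval (s.reg 0) ∧ (c.run s₀).Agree K s' ∧ ∀ j, K ≤ j → j < k → s'.reg j = s.reg j := by
  induction c generalizing k with
  | store a i t =>
    obtain ⟨f, hf⟩ := i.exists_runs_compile k (by omega) (hc.1.mono hk)
    obtain ⟨g, hg⟩ := t.exists_runs_compile (k + 1) (by omega) (hc.2.mono (by omega))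
    refine ⟨f + g + Polynomial.C 3, fun s s₀ h₀ => ?_⟩
    obtain ⟨τ, s', hr, hτ, hs, hv⟩ := hf s
    obtain ⟨τ', s'', hr', hτ', hs', hv'⟩ := hg s'
    rw [hs.2 0 (by omega)] at hτ'
    have hs₁ := h₀.trans (hs.mono hk)
    have hs₂ := hs₁.trans (hs'.mono (by omega))
    refine ⟨_, _, hr.seq (hr'.seq (Runs.store _ _ _ _)), ?_, ⟨?_, ?_⟩, ?_⟩
    · simp only [Expr.cost, Polynomial.eval_add, Polynomial.eval_C]
      omega
    · simp only [Expr.eval, run, State.setArr, hv', hs'.2 k (by omega), hv, hs₂.1,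
        CountTerm.eval_congr hK hc.1 h₀, CountTerm.eval_congr hK hc.2 hs₁]
    · intro j hj
      simp [run, hs₂.2 j hj]
    · intro j _ hj
      simp [hs'.2 j (by omega), hs.2 j hj]
  | seq c d ihc ihd =>
    obtain ⟨f, hf⟩ := ihc hc.1 k hk
    obtain ⟨g, hg⟩ := ihd hc.2 k hk
    refine ⟨f + g, fun s s₀ h₀ => ?_⟩
    obtain ⟨τ, s', hr, hτ, hs, hsj⟩ := hf s s₀ h₀
    obtain ⟨τ', s'', hr', hτ', hs', hsj'⟩ := hg s' _ hs
    rw [hs.2 0 hK, run_reg_zero hc.1, ← h₀.2 0 hK] at hτ'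
    exact ⟨_, _, hr.seq hr', by simp only [Polynomial.eval_add]; omega, hs', fun j h h' =>
      (hsj' j h h').trans (hsj j h h')⟩
  | loop x c ih =>
    obtain ⟨hx0, hxK, hc⟩ := hc
    obtain ⟨f, hf⟩ := ih hc (k + 1) (by omega)
    refine ⟨Polynomial.X * (f + Polynomial.C 12) + Polynomial.C 12, fun s s₀ h₀ => ?_⟩
    set n := s.reg 0 with hn
    have hs0 : s₀.reg 0 = n := (h₀.2 0 hK).symm
    let F : State → ℕ → State := fun s' i => c.run (s'.setReg x i)
    have hF0 : ∀ l : List ℕ, (l.foldl F s₀).reg 0 = n := by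
      intro l
      induction l using List.reverseRecOn with
      | nil => exact hs0
      | append_singleton l i ihl =>
        rw [List.foldl_append]
        simp [F, run_reg_zero hc, hx0.symm, ihl]
    -- The reference state after `i` rounds is the fold over the first `i` values.
    let I : ℕ → State → Prop := fun i s' =>
      s'.reg k = i ∧ ((List.range i).foldl F s₀).Agree K s' ∧
        ∀ j, K ≤ j → j < k → s'.reg j = s.reg j
    have hI : ∀ i s', I i s' → s'.reg 0 = n ∧ s'.reg k = i := fun i s' h =>
      ⟨by rw [h.2.1.2 0 hK, hF0], h.1⟩
    obtain ⟨τ, s', hr, hτ, h1, h2, h3⟩ := exists_runs_loop (x := k) (n := n) (T := f.eval n + 8)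
      (p := .seq (.assign x (.reg k)) (.seq (c.compile (k + 1))
          (.assign k (.add (.reg k) (.const 1))))) I hI
      (by
        rintro i hi s₁ ⟨h1, h2, h3⟩
        obtain ⟨τ, s', hr, hτ, hs, hsj⟩ := hf (s₁.setReg x i) _ (h2.setReg x i)
        have hr₁ : Runs (.assign x (.reg k)) s₁ 2 (s₁.setReg x i) := by
          simpa [Expr.eval, Expr.cost, h1] using Runs.assign s₁ x (.reg k)
        refine ⟨_, _, hr₁.seq (hr.seq (Runs.assign _ _ _)), ?_, ?_, ⟨?_, ?_⟩, ?_⟩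
        · rw [State.setReg_reg, if_neg hx0.symm, (hI i s₁ ⟨h1, h2, h3⟩).1] at hτ
          simp only [Expr.cost]
          omega
        · have : k ≠ x := by omega
          simp [Expr.eval, hsj k hk (by omega), this, h1]
        · simp [List.range_succ, F, hs.1]
        · intro j hj
          have : j ≠ k := by omega
          simp [List.range_succ, F, hs.2 j hj, this]
        · intro j hj hjk
          have : j ≠ x := by omega
          simp [hjk.ne, hsj j hj (by omega), this, h3 j hj hjk])
      (s := s.setReg k 0)
      ⟨by simp, h₀.trans ⟨rfl, fun j hj => by simp [(hj.trans_le hk).ne]⟩,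
        fun j _ hj => by simp [hj.ne]⟩
    refine ⟨_, s', (Runs.assign _ _ _).seq hr, ?_, ?_, h3⟩
    · simp only [Expr.cost, Polynomial.eval_add, Polynomial.eval_mul, Polynomial.eval_X,
        Polynomial.eval_C]
      have : f.eval n + 8 + 4 = f.eval n + 12 := rfl
      rw [this] at hτ
      omega
    · simpa only [run, hs0] using h2

end Command

end RAM

/-! ### Jumps of length two in a split graph -/

set_option linter.unusedSectionVars false

namespace SplitReconf

open Finset

variable {V : Type*} [Fintype V] [DecidableEq V] {G : SimpleGraph V} {A : Finset V}

/-- The graph whose edges are the edges of `G` that do not lie inside `A`. -/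
def crossGraph (G : SimpleGraph V) (A : Finset V) : SimpleGraph V where
  Adj u v := G.Adj u v ∧ ¬ (u ∈ A ∧ v ∈ A)
  symm := ⟨fun _ _ h => ⟨h.1.symm, fun h' => h.2 h'.symm⟩⟩
  loopless := ⟨fun _ h => G.loopless.irrefl _ h.1⟩

open Classical in
/-- The neighbours of `a` outside `A`. -/
noncomputable def outerNbrs (G : SimpleGraph V) (A : Finset V) (a : V) : Finset V :=
  {v | v ∉ A ∧ G.Adj a v}

open Classical in
/-- The vertices outside `A` in the component of `u` in `crossGraph G A`. -/
noncomputable def outerComp (G : SimpleGraph V) (A : Finset V) (u : V) : Finset V :=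
  {v | v ∉ A ∧ (crossGraph G A).Reachable u v}

open Classical in
/-- The isolated vertices outside `A`.  Their tokens can never move. -/
noncomputable def frozen (G : SimpleGraph V) (A : Finset V) : Finset V :=
  {v | v ∉ A ∧ ∀ w, ¬ G.Adj v w}

open Classical in
/-- The vertices outside `A` that have a neighbour. -/
noncomputable def movable (G : SimpleGraph V) (A : Finset V) : Finset V :=
  {v | v ∉ A ∧ ∃ w, G.Adj v w}

@[simp] theorem mem_outerNbrs {a v : V} : v ∈ outerNbrs G A a ↔ v ∉ A ∧ G.Adj a v := by
  simp [outerNbrs]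

@[simp] theorem mem_outerComp {u v : V} :
    v ∈ outerComp G A u ↔ v ∉ A ∧ (crossGraph G A).Reachable u v := by
  simp [outerComp]

@[simp] theorem mem_frozen {v : V} : v ∈ frozen G A ↔ v ∉ A ∧ ∀ w, ¬ G.Adj v w := by
  simp [frozen]

@[simp] theorem mem_movable {v : V} : v ∈ movable G A ↔ v ∉ A ∧ ∃ w, G.Adj v w := by
  simp [movable]

/-- If `X` has a token that is not frozen, this says that `X` can be transformed, by jumps between
vertices outside `A` and at most one jump to `a`, into a set with a token on `a`: either it has one already, or all but at most
one of the tokens on neighbours of `a` can be moved away within the component of `a`. -/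
def Enters (G : SimpleGraph V) (A X : Finset V) (a : V) : Prop :=
  a ∈ A ∧ (a ∈ X ∨ Disjoint X A ∧
    #(X ∩ outerComp G A a) + #(outerNbrs G A a) ≤ #(outerComp G A a) + 1)

/-- The vertices `a` and `b` of `A` can both carry a token when there are `k` tokens that are not
frozen, and the token set can be transformed from one situation into the other without passing
through token sets with a token on a third vertex of `A`. -/
def Linked (G : SimpleGraph V) (A : Finset V) (k : ℕ) (a b : V) : Prop :=
  (a ∈ A ∧ k + #(outerNbrs G A a) ≤ #(movable G A) + 1) ∧
  (b ∈ A ∧ k + #(outerNbrs G A b) ≤ #(movable G A) + 1) ∧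
  ((crossGraph G A).Reachable a b ∨
    k + #(outerNbrs G A a) + #(outerNbrs G A b) ≤ #(movable G A) + 2)

/-- The criterion for reconfigurability: apart from the evident invariants, either both sets avoid
`A` and have equally many tokens in each component of `crossGraph G A`, or they enter `A` at
vertices that a chain of links connects. -/
def Criterion (G : SimpleGraph V) (A X Y : Finset V) : Prop :=
  #X = #Y ∧ X ∩ frozen G A = Y ∩ frozen G A ∧
  ((Disjoint X A ∧ Disjoint Y A ∧ ∀ u, #(X ∩ outerComp G A u) = #(Y ∩ outerComp G A u)) ∨
    ∃ a b, Enters G A X a ∧ Enters G A Y b ∧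
      Relation.ReflTransGen (Linked G A #(X \ frozen G A)) a b)

theorem edist_le_two_iff {u v : V} :
    G.edist u v ≤ (2 : ℕ) ↔ u = v ∨ G.Adj u v ∨ ∃ w, G.Adj u w ∧ G.Adj w v := by
  constructor
  · intro h
    have hr : G.Reachable u v := by
      by_contra hr
      rw [SimpleGraph.edist_eq_top_of_not_reachable hr] at h
      exact absurd (top_le_iff.1 h) (ENat.natCast_ne_top 2)
    obtain ⟨p, hp⟩ := hr.exists_walk_length_eq_edist
    rw [← hp, Nat.cast_le] at h
    match p, h with
    | .nil, _ => exact Or.inl rfl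
    | .cons h .nil, _ => exact Or.inr (Or.inl h)
    | .cons h (.cons h' .nil), _ => exact Or.inr (Or.inr ⟨_, h, h'⟩)
    | .cons _ (.cons _ (.cons _ _)), h => simp only [SimpleGraph.Walk.length_cons] at h; omega
  · rintro (rfl | h | ⟨w, h, h'⟩)
    · simp
    · exact (SimpleGraph.Walk.edist_le (.cons h .nil)).trans (by simp)
    · exact (SimpleGraph.Walk.edist_le (.cons h (.cons h' .nil))).trans (by simp)

theorem jumpStep_swap {X : Finset V} {u v : V} (hX : G.IsIndepSet (X : Set V)) (hu : u ∈ X)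
    (hv : v ∉ X) (hY : G.IsIndepSet (insert v (X.erase u) : Finset V))
    (h : u = v ∨ G.Adj u v ∨ ∃ w, G.Adj u w ∧ G.Adj w v) :
    JumpStep G 2 X (insert v (X.erase u)) := by
  have huv : u ≠ v := fun h => hv (h ▸ hu)
  have h1 : X \ insert v (X.erase u) = {u} := by ext; grind
  have h2 : insert v (X.erase u) \ X = {v} := by ext; grind
  refine ⟨hX, hY, by simp [h1], by simp [h2], ?_⟩
  rw [h1, h2]
  simpa using edist_le_two_iff.2 h

theorem exists_of_jumpStep {X Y : Finset V} (h : JumpStep G 2 X Y) :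
    ∃ u ∈ X, ∃ v ∉ X, Y = insert v (X.erase u) ∧
      (G.Adj u v ∨ ∃ w, G.Adj u w ∧ G.Adj w v) := by
  obtain ⟨-, -, h1, h2, h3⟩ := h
  obtain ⟨u, hu⟩ := card_eq_one.1 h1
  obtain ⟨v, hv⟩ := card_eq_one.1 h2
  have hu' : u ∈ X \ Y := by simp [hu]
  have hv' : v ∈ Y \ X := by simp [hv]
  have h4 := edist_le_two_iff.1 (h3 u hu' v hv')
  rw [mem_sdiff] at hu' hv'
  refine ⟨u, hu'.1, v, hv'.2, ?_, h4.resolve_left fun h => hu'.2 (h ▸ hv'.1)⟩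
  ext x
  have h5 := Finset.ext_iff.1 hu x
  have h6 := Finset.ext_iff.1 hv x
  grind

theorem jumpStep_symm {X Y : Finset V} (h : JumpStep G 2 X Y) : JumpStep G 2 Y X :=
  ⟨h.2.1, h.1, h.2.2.2.1, h.2.2.1, fun u hu v hv => by
    rw [SimpleGraph.edist_comm]; exact h.2.2.2.2 v hv u hu⟩

theorem reconfigurable_symm {X Y : Finset V} (h : Reconfigurable G 2 X Y) :
    Reconfigurable G 2 Y X := by
  induction h with
  | refl => exact .refl
  | tail _ h ih => exact .head (jumpStep_symm h) ih

theorem isIndepSet_of_reconfigurable {X Y : Finset V} (hX : G.IsIndepSet (X : Set V))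
    (h : Reconfigurable G 2 X Y) : G.IsIndepSet (Y : Set V) := by
  cases h with
  | refl => exact hX
  | tail _ h => exact h.2.1

theorem outerNbrs_subset_outerComp (a : V) : outerNbrs G A a ⊆ outerComp G A a := by
  intro v hv
  rw [mem_outerNbrs] at hv
  rw [mem_outerComp]
  exact ⟨hv.1, SimpleGraph.Adj.reachable ⟨hv.2, fun h => hv.1 h.2⟩⟩

theorem outerNbrs_subset_movable (a : V) : outerNbrs G A a ⊆ movable G A := by
  intro v hv
  rw [mem_outerNbrs] at hv
  rw [mem_movable]
  exact ⟨hv.1, a, hv.2.symm⟩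

theorem outerComp_subset_movable {a : V} (ha : a ∈ A) : outerComp G A a ⊆ movable G A := by
  intro v hv
  rw [mem_outerComp] at hv
  rw [mem_movable]
  refine ⟨hv.1, ?_⟩
  have hav : v ≠ a := fun h => hv.1 (h ▸ ha)
  obtain ⟨p⟩ := hv.2.symm
  cases p with
  | nil => exact absurd rfl hav
  | cons h _ => exact ⟨_, h.1⟩

theorem disjoint_outerComp_of_not_reachable {a b : V}
    (h : ¬ (crossGraph G A).Reachable a b) : Disjoint (outerComp G A a) (outerComp G A b) := by
  rw [Finset.disjoint_left]
  intro v hv hv'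
  exact h ((mem_outerComp.1 hv).2.trans (mem_outerComp.1 hv').2.symm)

section Partition

variable (hA : G.IsClique (A : Set V)) (hB : G.IsIndepSet ((A : Set V)ᶜ))

include hB in
theorem isIndepSet_of_disjoint {X : Finset V} (hX : Disjoint X A) :
    G.IsIndepSet (X : Set V) := fun _ hu _ hv huv =>
  hB (fun h => Finset.disjoint_left.1 hX hu h) (fun h => Finset.disjoint_left.1 hX hv h) huv

include hB in
theorem mem_of_adj {u v : V} (hu : u ∉ A) (h : G.Adj u v) : v ∈ A := by
  by_contra hv
  exact hB hu hv h.ne h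

include hB in
theorem isIndepSet_of_unique {X : Finset V} {a : V} (h1 : ∀ v ∈ X, v ∈ A → v = a)
    (h2 : ∀ v ∈ X, ¬ G.Adj a v) : G.IsIndepSet (X : Set V) := by
  intro u hu v hv huv h
  by_cases hua : u ∈ A
  · rw [h1 u hu hua] at h
    exact h2 v hv h
  · rw [h1 v hv (mem_of_adj hB hua h)] at h
    exact h2 u hu h.symm

include hA in
theorem eq_of_mem_of_isIndepSet {X : Finset V} (hX : G.IsIndepSet (X : Set V)) {a b : V}
    (ha : a ∈ X) (hb : b ∈ X) (haA : a ∈ A) (hbA : b ∈ A) : a = b := by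
  by_contra hab
  exact hX ha hb hab (hA haA hbA hab)

include hA hB in
theorem adj_or_exists_of_mem_movable {a v : V} (ha : a ∈ A) (hv : v ∈ movable G A) :
    v = a ∨ G.Adj v a ∨ ∃ w, G.Adj v w ∧ G.Adj w a := by
  obtain ⟨hv, w, hw⟩ := mem_movable.1 hv
  by_cases hwa : w = a
  · exact Or.inr (Or.inl (hwa ▸ hw))
  · exact Or.inr (Or.inr ⟨w, hw, hA (mem_of_adj hB hv hw) ha hwa⟩)

theorem insert_erase_insert_erase {X : Finset V} {u v w : V} (hw : w ∈ X) (huw : u ≠ w)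
    (huv : u ≠ v) : insert w ((insert v (X.erase w)).erase u) = insert v (X.erase u) := by
  ext x
  simp only [mem_insert, mem_erase]
  grind

theorem insert_erase_sdiff {X Y : Finset V} {u v : V} (hv : v ∈ Y) :
    insert v (X.erase u) \ Y = (X \ Y).erase u := by
  ext x
  simp only [mem_insert, mem_erase, mem_sdiff]
  grind

theorem card_insert_erase {X : Finset V} {u v : V} (hu : u ∈ X) (hv : v ∉ X) :
    #(insert v (X.erase u)) = #X := by
  rw [card_insert_of_notMem (by simp [hv]), card_erase_add_one hu]

theorem card_insert_erase_inter {X K : Finset V} {u v : V} (hu : u ∈ X) (hv : v ∉ X)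
    (h : u ∈ K ↔ v ∈ K) : #(insert v (X.erase u) ∩ K) = #(X ∩ K) := by
  by_cases huK : u ∈ K
  · have : insert v (X.erase u) ∩ K = insert v ((X ∩ K).erase u) := by ext; grind
    rw [this, card_insert_erase (by simp [hu, huK]) (by simp [hv])]
  · have : insert v (X.erase u) ∩ K = X ∩ K := by ext; grind
    rw [this]

/-! ### Necessity of the criterion -/

theorem not_mem_frozen_of_jump {u v : V}
    (h : G.Adj u v ∨ ∃ w, G.Adj u w ∧ G.Adj w v) : u ∉ frozen G A ∧ v ∉ frozen G A := by
  simp only [mem_frozen, not_and, not_forall, not_not]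
  rcases h with h | ⟨w, h, h'⟩
  · exact ⟨fun _ => ⟨v, h⟩, fun _ => ⟨u, h.symm⟩⟩
  · exact ⟨fun _ => ⟨w, h⟩, fun _ => ⟨w, h'.symm⟩⟩

theorem inter_frozen_of_jumpStep {X Y : Finset V} (h : JumpStep G 2 X Y) :
    X ∩ frozen G A = Y ∩ frozen G A := by
  obtain ⟨u, hu, v, hv, rfl, hj⟩ := exists_of_jumpStep h
  obtain ⟨h1, h2⟩ := not_mem_frozen_of_jump (A := A) hj
  ext; grind

theorem card_eq_of_jumpStep {X Y : Finset V} (h : JumpStep G 2 X Y) : #X = #Y := by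
  obtain ⟨u, hu, v, hv, rfl, h⟩ := exists_of_jumpStep h
  exact (card_insert_erase hu hv).symm

theorem card_sdiff_eq {X Y F : Finset V} (h : #X = #Y) (h' : X ∩ F = Y ∩ F) :
    #(X \ F) = #(Y \ F) := by
  have h1 := card_sdiff_add_card_inter X F
  have h2 := card_sdiff_add_card_inter Y F
  rw [h'] at h1
  omega

include hA in
/-- With a token on `a`, every other token outside `frozen G A` is on a vertex of `movable G A`
that is not adjacent to `a`. -/
theorem sdiff_frozen_subset {X : Finset V} (hX : G.IsIndepSet (X : Set V)) {a : V} (ha : a ∈ X)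
    (haA : a ∈ A) : X \ frozen G A ⊆ insert a (movable G A \ outerNbrs G A a) := by
  intro v hv
  rw [mem_sdiff] at hv
  by_cases hva : v = a
  · simp [hva]
  have hvA : v ∉ A := fun h => hva (eq_of_mem_of_isIndepSet hA hX hv.1 ha h haA)
  have : ¬ G.Adj a v := fun h => hX ha hv.1 (Ne.symm hva) h
  have h2 := hv.2
  simp only [mem_frozen, not_and, not_forall, not_not] at h2
  simp [hva, hvA, this, h2 hvA]

include hA in
theorem card_sdiff_frozen_add_le {X : Finset V} (hX : G.IsIndepSet (X : Set V)) {a : V}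
    (ha : a ∈ X) (haA : a ∈ A) :
    #(X \ frozen G A) + #(outerNbrs G A a) ≤ #(movable G A) + 1 := by
  have h1 := card_le_card (sdiff_frozen_subset hA hX ha haA)
  have h2 := card_insert_le a (movable G A \ outerNbrs G A a)
  have h3 := card_sdiff_add_card_eq_card (outerNbrs_subset_movable (G := G) (A := A) a)
  omega

include hA in
theorem enters_of_jump_out {X : Finset V} (hX : G.IsIndepSet (X : Set V)) {a v : V}
    (ha : a ∈ X) (haA : a ∈ A) (hv : v ∉ A) :
    Disjoint (insert v (X.erase a)) A ∧ Enters G A (insert v (X.erase a)) a := by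
  have hd : Disjoint (insert v (X.erase a)) A := by
    rw [Finset.disjoint_left]
    intro w hw hwA
    rcases mem_insert.1 hw with rfl | hw
    · exact hv hwA
    · exact (mem_erase.1 hw).1
        (eq_of_mem_of_isIndepSet hA hX (mem_erase.1 hw).2 ha hwA haA)
  refine ⟨hd, haA, Or.inr ⟨hd, ?_⟩⟩
  have h1 : insert v (X.erase a) ∩ outerComp G A a ⊆
      insert v (outerComp G A a \ outerNbrs G A a) := by
    intro w hw
    obtain ⟨hw, hwK⟩ := mem_inter.1 hw
    rcases mem_insert.1 hw with rfl | hw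
    · simp
    · obtain ⟨hwa, hw⟩ := mem_erase.1 hw
      refine mem_insert_of_mem (mem_sdiff.2 ⟨hwK, fun h => ?_⟩)
      exact hX ha hw hwa.symm (mem_outerNbrs.1 h).2
  have h2 := card_le_card h1
  have h3 := card_insert_le v (outerComp G A a \ outerNbrs G A a)
  have h4 := card_sdiff_add_card_eq_card (outerNbrs_subset_outerComp (G := G) (A := A) a)
  omega

include hA in
theorem linked_of_jump {X : Finset V} {a b : V} (hX : G.IsIndepSet (X : Set V)) (ha : a ∈ X)
    (haA : a ∈ A) (hb : b ∉ X) (hbA : b ∈ A)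
    (hY : G.IsIndepSet (insert b (X.erase a) : Finset V))
    (hF : X ∩ frozen G A = insert b (X.erase a) ∩ frozen G A) :
    Linked G A #(X \ frozen G A) a b := by
  have hbY : b ∈ insert b (X.erase a) := mem_insert_self _ _
  have hk := card_sdiff_eq (card_insert_erase ha hb).symm hF
  have h1 := card_sdiff_frozen_add_le hA hX ha haA
  have h2 := card_sdiff_frozen_add_le hA hY hbY hbA
  refine ⟨⟨haA, h1⟩, ⟨hbA, hk ▸ h2⟩, or_iff_not_imp_left.2 fun hr => ?_⟩
  have hd : Disjoint (outerNbrs G A a) (outerNbrs G A b) :=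
    (disjoint_outerComp_of_not_reachable hr).mono (outerNbrs_subset_outerComp a)
      (outerNbrs_subset_outerComp b)
  have h3 : X \ frozen G A ⊆
      insert a (movable G A \ (outerNbrs G A a ∪ outerNbrs G A b)) := by
    intro v hv
    have hv1 := sdiff_frozen_subset hA hX ha haA hv
    by_cases hva : v = a
    · simp [hva]
    have hvX := (mem_sdiff.1 hv).1
    have hvb : v ≠ b := fun h => hb (h ▸ hvX)
    have hnb : v ∉ outerNbrs G A b := fun h =>
      hY hbY (by simp [hva, hvX]) hvb.symm (mem_outerNbrs.1 h).2
    grind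
  have h4 := card_le_card h3
  have h5 := card_insert_le a (movable G A \ (outerNbrs G A a ∪ outerNbrs G A b))
  have h6 := card_sdiff_add_card_eq_card (union_subset
    (outerNbrs_subset_movable (G := G) (A := A) a) (outerNbrs_subset_movable b))
  rw [card_union_of_disjoint hd] at h6
  omega

include hA hB in
theorem criterion_of_jumpStep {X Y : Finset V} (h : JumpStep G 2 X Y) : Criterion G A X Y := by
  have hF := inter_frozen_of_jumpStep (A := A) h
  refine ⟨card_eq_of_jumpStep h, hF, ?_⟩
  obtain ⟨hX, hY, -⟩ := id h
  obtain ⟨u, hu, v, hv, rfl, hj⟩ := exists_of_jumpStep h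
  have huv : u ≠ v := fun h => hv (h ▸ hu)
  by_cases huA : u ∈ A
  · right
    by_cases hvA : v ∈ A
    · exact ⟨u, v, ⟨huA, Or.inl hu⟩, ⟨hvA, Or.inl (mem_insert_self _ _)⟩,
        .single (linked_of_jump hA hX hu huA hv hvA hY hF)⟩
    · exact ⟨u, u, ⟨huA, Or.inl hu⟩, (enters_of_jump_out hA hX hu huA hvA).2, .refl⟩
  · by_cases hvA : v ∈ A
    · right
      have hXY : X = insert u ((insert v (X.erase u)).erase v) := by ext; grind
      have := (enters_of_jump_out hA hY (mem_insert_self _ _) hvA huA).2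
      rw [← hXY] at this
      exact ⟨v, v, this, ⟨hvA, Or.inl (mem_insert_self _ _)⟩, .refl⟩
    · by_cases hXA : Disjoint X A
      · left
        refine ⟨hXA, ?_, fun w => (card_insert_erase_inter hu hv ?_).symm⟩
        · rw [Finset.disjoint_left] at hXA ⊢
          grind
        · have hr : (crossGraph G A).Reachable u v := by
            rcases hj with h | ⟨w, h, h'⟩
            · exact absurd (mem_of_adj hB huA h) hvA
            · exact (SimpleGraph.Adj.reachable (G := crossGraph G A) ⟨h, fun h => huA h.1⟩).trans
                (SimpleGraph.Adj.reachable ⟨h', fun h => hvA h.2⟩)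
          simp only [mem_outerComp, huA, hvA, not_false_eq_true, true_and]
          exact ⟨fun h => h.trans hr, fun h => h.trans hr.symm⟩
      · right
        obtain ⟨a, haX, haA⟩ := Finset.not_disjoint_iff.1 hXA
        have hau : a ≠ u := fun h => huA (h ▸ haA)
        exact ⟨a, a, ⟨haA, Or.inl haX⟩, ⟨haA, Or.inl (by simp [hau, haX])⟩, .refl⟩

/-- Vertices of `A` at which the same token set enters are linked, provided that the token set
itself avoids `A`. -/
theorem linked_of_enters {X : Finset V} {a b : V} (hX : Disjoint X A) (ha : Enters G A X a)
    (hb : Enters G A X b) : Linked G A #(X \ frozen G A) a b := by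
  obtain ⟨haA, ha⟩ := ha
  obtain ⟨hbA, hb⟩ := hb
  replace ha := (ha.resolve_left fun h => Finset.disjoint_left.1 hX h haA).2
  replace hb := (hb.resolve_left fun h => Finset.disjoint_left.1 hX h hbA).2
  have hXm : X \ frozen G A ⊆ movable G A := by
    intro v hv
    rw [mem_sdiff] at hv
    have hvA : v ∉ A := Finset.disjoint_left.1 hX hv.1
    have h2 := hv.2
    simp only [mem_frozen, not_and, not_forall, not_not] at h2
    exact mem_movable.2 ⟨hvA, h2 hvA⟩
  -- Tokens outside a union `K` of components are at most as many as the places outside `K`.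
  have key : ∀ K ⊆ movable G A, #(X \ frozen G A) + #K ≤ #(X ∩ K) + #(movable G A) := by
    intro K hK
    have h1 : X \ frozen G A ⊆ (X ∩ K) ∪ (movable G A \ K) := by
      intro v hv
      have := hXm hv
      grind
    have h2 := card_le_card h1
    have h3 := card_union_le (X ∩ K) (movable G A \ K)
    have h4 := card_sdiff_add_card_eq_card hK
    omega
  have hKa := outerComp_subset_movable (G := G) haA
  have hKb := outerComp_subset_movable (G := G) hbA
  have h1 := key _ hKa
  have h2 := key _ hKb
  refine ⟨⟨haA, by omega⟩, ⟨hbA, by omega⟩, or_iff_not_imp_left.2 fun hr => ?_⟩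
  have hd := disjoint_outerComp_of_not_reachable hr
  have h3 := key _ (union_subset hKa hKb)
  rw [inter_union_distrib_left, card_union_of_disjoint hd,
    card_union_of_disjoint (hd.mono inter_subset_right inter_subset_right)] at h3
  omega

include hA in
theorem Criterion.trans {X Y Z : Finset V} (hY : G.IsIndepSet (Y : Set V))
    (h : Criterion G A X Y) (h' : Criterion G A Y Z) : Criterion G A X Z := by
  obtain ⟨h1, h2, h3⟩ := h
  obtain ⟨h1', h2', h3'⟩ := h'
  refine ⟨h1.trans h1', h2.trans h2', ?_⟩
  have hk := card_sdiff_eq h1 h2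
  rcases h3 with ⟨hX, hYd, hXY⟩ | ⟨a, b, ha, hb, hab⟩ <;>
    rcases h3' with ⟨hYd', hZ, hYZ⟩ | ⟨c, d, hc, hd, hcd⟩
  · exact Or.inl ⟨hX, hZ, fun u => (hXY u).trans (hYZ u)⟩
  · refine Or.inr ⟨c, d, ⟨hc.1, Or.inr ⟨hX, ?_⟩⟩, hd, hk ▸ hcd⟩
    rw [hXY]
    exact (hc.2.resolve_left fun h => Finset.disjoint_left.1 hYd h hc.1).2
  · refine Or.inr ⟨a, b, ha, ⟨hb.1, Or.inr ⟨hZ, ?_⟩⟩, hab⟩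
    rw [← hYZ]
    exact (hb.2.resolve_left fun h => Finset.disjoint_left.1 hYd' h hb.1).2
  · refine Or.inr ⟨a, d, ha, hd, hab.trans ?_⟩
    rw [hk]
    refine Relation.ReflTransGen.trans ?_ hcd
    by_cases hYd : Disjoint Y A
    · exact .single (linked_of_enters hYd hb hc)
    · have hbY := hb.2.resolve_right fun h => hYd h.1
      have hcY := hc.2.resolve_right fun h => hYd h.1
      rw [eq_of_mem_of_isIndepSet hA hY hbY hcY hb.1 hc.1]

include hA hB in
theorem criterion_of_reconfigurable {X Y : Finset V} (h : Reconfigurable G 2 X Y) :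
    Criterion G A X Y := by
  induction h with
  | refl =>
    refine ⟨rfl, rfl, ?_⟩
    by_cases hXA : Disjoint X A
    · exact Or.inl ⟨hXA, hXA, fun _ => rfl⟩
    · obtain ⟨a, haX, haA⟩ := Finset.not_disjoint_iff.1 hXA
      exact Or.inr ⟨a, a, ⟨haA, Or.inl haX⟩, ⟨haA, Or.inl haX⟩, .refl⟩
  | tail _ h ih => exact ih.trans hA h.1 (criterion_of_jumpStep hA hB h)

/-! ### Sufficiency of the criterion -/

/-- Two vertices outside `A` with a common neighbour. -/
def CommonNbr (G : SimpleGraph V) (A : Finset V) (u v : V) : Prop :=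
  u ∉ A ∧ v ∉ A ∧ ∃ w, G.Adj u w ∧ G.Adj w v

include hB in
theorem reflTransGen_commonNbr {u v : V} (hu : u ∉ A) (hv : v ∉ A)
    (h : (crossGraph G A).Reachable u v) : Relation.ReflTransGen (CommonNbr G A) u v := by
  -- A path in `crossGraph G A` alternates between `A` and its complement.
  suffices H : ∀ x, (crossGraph G A).Reachable u x →
      (x ∉ A → Relation.ReflTransGen (CommonNbr G A) u x) ∧
      (x ∈ A → ∃ y ∉ A, Relation.ReflTransGen (CommonNbr G A) u y ∧ G.Adj y x) from
    (H v h).1 hv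
  intro x hx
  rw [SimpleGraph.reachable_iff_reflTransGen] at hx
  induction hx with
  | refl => exact ⟨fun _ => .refl, fun h => absurd h hu⟩
  | @tail y z _ h ih =>
    refine ⟨fun hz => ?_, fun hz => ?_⟩
    · obtain ⟨w, hw, huw, hwy⟩ := ih.2 (mem_of_adj hB hz h.1.symm)
      exact huw.tail ⟨hw, hz, y, hwy, h.1⟩
    · have hy : y ∉ A := fun hy => h.2 ⟨hy, hz⟩
      exact ⟨y, hy, ih.1 hy, h.1⟩

theorem disjoint_insert_erase {X : Finset V} {u v : V} (hX : Disjoint X A) (hv : v ∉ A) :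
    Disjoint (insert v (X.erase u)) A := by
  rw [Finset.disjoint_left] at hX ⊢
  grind

include hB in
/-- Outside `A`, tokens block each other only apparently: a token reaches every free vertex of its
component, since instead of passing another token it can take over the way of that token. -/
theorem reconfigurable_slide {X : Finset V} (hX : Disjoint X A) {u v : V} (hu : u ∈ X)
    (hv : v ∉ X) (hvA : v ∉ A) (h : (crossGraph G A).Reachable u v) :
    Reconfigurable G 2 X (insert v (X.erase u)) := by
  have huA : u ∉ A := Finset.disjoint_left.1 hX hu
  have hT := reflTransGen_commonNbr hB huA hvA h
  clear huA h
  induction hT using Relation.ReflTransGen.head_induction_on generalizing X with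
  | refl => exact absurd hu hv
  | @head u w h _ ih =>
    by_cases huw : u = w
    · subst huw
      exact ih hX hu hv
    by_cases hw : w ∈ X
    · have h1 := ih hX hw hv
      have huv : u ≠ v := fun h => hv (h ▸ hu)
      have hwv : w ≠ v := fun h => hv (h ▸ hw)
      have hd := disjoint_insert_erase (u := w) hX hvA
      have h2 := jumpStep_swap (G := G) (u := u) (v := w) (isIndepSet_of_disjoint hB hd)
        (by simp [huw, hu]) (by simp [hwv])
        (isIndepSet_of_disjoint hB (disjoint_insert_erase hd h.2.1)) (Or.inr (Or.inr h.2.2))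
      rw [insert_erase_insert_erase hw huw huv] at h2
      exact h1.tail h2
    · have hd := disjoint_insert_erase (u := u) hX h.2.1
      have h2 := jumpStep_swap (isIndepSet_of_disjoint hB hX) hu hw
        (isIndepSet_of_disjoint hB hd) (Or.inr (Or.inr h.2.2))
      by_cases hwv : w = v
      · subst hwv
        exact .single h2
      have h1 := ih hd (mem_insert_self _ _) (by simp [Ne.symm hwv, hv])
      rw [erase_insert (by simp [hw])] at h1
      exact .head h2 h1

include hB in
theorem reconfigurable_of_card_inter_eq {X Y : Finset V} (hX : Disjoint X A)
    (hXY : #X = #Y) (h : ∀ u, #(X ∩ outerComp G A u) = #(Y ∩ outerComp G A u)) :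
    Reconfigurable G 2 X Y := by
  induction hm : #(X \ Y) generalizing X with
  | zero =>
    rw [card_eq_zero, sdiff_eq_empty_iff_subset] at hm
    rw [eq_of_subset_of_card_le hm hXY.ge]
    exact .refl
  | succ m ih =>
    obtain ⟨u, hu⟩ := card_pos.1 (by omega : 0 < #(X \ Y))
    obtain ⟨huX, huY⟩ := mem_sdiff.1 hu
    have huA : u ∉ A := Finset.disjoint_left.1 hX huX
    obtain ⟨v, hv⟩ : ∃ v, v ∈ (Y ∩ outerComp G A u) \ (X ∩ outerComp G A u) := by
      by_contra! hc
      have h1 : Y ∩ outerComp G A u ⊆ X ∩ outerComp G A u := fun v hv => by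
        by_contra hv'
        exact hc v (mem_sdiff.2 ⟨hv, hv'⟩)
      have h2 := eq_of_subset_of_card_le h1 (h u).le
      have h3 : u ∈ X ∩ outerComp G A u := by simp [huX, huA]
      rw [← h2] at h3
      exact huY (mem_inter.1 h3).1
    obtain ⟨hvY, hvX, hvK⟩ : v ∈ Y ∧ v ∉ X ∧ v ∈ outerComp G A u := by grind
    obtain ⟨hvA, hr⟩ := mem_outerComp.1 hvK
    refine (reconfigurable_slide hB hX huX hvX hvA hr).trans
      (ih (disjoint_insert_erase hX hvA) ((card_insert_erase huX hvX).trans hXY)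
        (fun w => (card_insert_erase_inter huX hvX ?_).trans (h w)) ?_)
    · simp only [mem_outerComp, huA, hvA, not_false_eq_true, true_and]
      exact ⟨fun h => h.trans hr, fun h => h.trans hr.symm⟩
    · rw [insert_erase_sdiff hvY, card_erase_of_mem hu, hm, Nat.add_sub_cancel]

include hB in
/-- If there is enough room in the component of `a`, then all but at most one of the tokens on the
neighbours of `a` can be moved away. -/
theorem exists_reconfigurable_card_le_one {X : Finset V} (hX : Disjoint X A) {a : V}
    (h : #(X ∩ outerComp G A a) + #(outerNbrs G A a) ≤ #(outerComp G A a) + 1) :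
    ∃ Y, Reconfigurable G 2 X Y ∧ Disjoint Y A ∧ #(Y ∩ outerNbrs G A a) ≤ 1 := by
  induction hm : #(X ∩ outerNbrs G A a) using Nat.strong_induction_on generalizing X with
  | h m ih =>
    by_cases hm1 : m ≤ 1
    · exact ⟨X, .refl, hX, hm ▸ hm1⟩
    obtain ⟨u, hu⟩ := card_pos.1 (by omega : 0 < #(X ∩ outerNbrs G A a))
    obtain ⟨huX, huN⟩ := mem_inter.1 hu
    have hNK := outerNbrs_subset_outerComp (G := G) (A := A) a
    obtain ⟨v, hvK, hvN, hvX⟩ : ∃ v ∈ outerComp G A a, v ∉ outerNbrs G A a ∧ v ∉ X := by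
      by_contra! hc
      have h1 : (X ∩ outerNbrs G A a) ∪ (outerComp G A a \ outerNbrs G A a) ⊆
          X ∩ outerComp G A a := by
        intro v hv
        have := hc v
        have := @hNK v
        grind
      have h2 := card_le_card h1
      rw [card_union_of_disjoint (by rw [Finset.disjoint_left]; grind)] at h2
      have h3 := card_sdiff_add_card_eq_card hNK
      omega
    obtain ⟨hvA, hav⟩ := mem_outerComp.1 hvK
    have hr := (mem_outerComp.1 (hNK huN)).2.symm.trans hav
    have h1 : insert v (X.erase u) ∩ outerNbrs G A a = (X ∩ outerNbrs G A a).erase u := by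
      rw [insert_inter_of_notMem hvN, erase_inter]
    obtain ⟨Y, hY, hYd⟩ := ih (m - 1) (by omega) (disjoint_insert_erase hX hvA)
      (by rwa [card_insert_erase_inter huX hvX (iff_of_true (hNK huN) hvK)])
      (by rw [h1, card_erase_of_mem hu, hm])
    exact ⟨Y, (reconfigurable_slide hB hX huX hvX hvA hr).trans hY, hYd⟩

include hA hB in
theorem card_eq_and_inter_frozen {X Y : Finset V} (h : Reconfigurable G 2 X Y) :
    #X = #Y ∧ X ∩ frozen G A = Y ∩ frozen G A :=
  have h := criterion_of_reconfigurable hA hB h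
  ⟨h.1, h.2.1⟩

include hA hB in
theorem exists_reconfigurable_mem {X : Finset V} {a : V}
    (hk : (X \ frozen G A).Nonempty) (h : Enters G A X a) :
    ∃ Y, Reconfigurable G 2 X Y ∧ a ∈ Y := by
  obtain ⟨haA, haX | ⟨hXA, h⟩⟩ := h
  · exact ⟨X, .refl, haX⟩
  obtain ⟨Y, hXY, hYA, hY1⟩ := exists_reconfigurable_card_le_one hB hXA h
  obtain ⟨h1, h2⟩ := card_eq_and_inter_frozen hA hB hXY
  have h3 := card_sdiff_eq h1 h2
  obtain ⟨u, huY, huF, hu⟩ : ∃ u ∈ Y, u ∉ frozen G A ∧ ∀ w ∈ Y, w ∈ outerNbrs G A a → w = u := by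
    by_cases hN : (Y ∩ outerNbrs G A a).Nonempty
    · obtain ⟨u, hu⟩ := hN
      obtain ⟨huY, huN⟩ := mem_inter.1 hu
      refine ⟨u, huY, fun h => (mem_frozen.1 h).2 a (mem_outerNbrs.1 huN).2.symm,
        fun w hw hwN => ?_⟩
      exact card_le_one.1 hY1 w (mem_inter.2 ⟨hw, hwN⟩) u hu
    · obtain ⟨u, hu⟩ := card_pos.1 (h3 ▸ card_pos.2 hk)
      obtain ⟨huY, huF⟩ := mem_sdiff.1 hu
      exact ⟨u, huY, huF, fun w hw hwN => absurd ⟨w, mem_inter.2 ⟨hw, hwN⟩⟩ hN⟩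
  have huA : u ∉ A := Finset.disjoint_left.1 hYA huY
  have hum : u ∈ movable G A := by
    simp only [mem_frozen, not_and, not_forall, not_not] at huF
    exact mem_movable.2 ⟨huA, huF huA⟩
  have haY : a ∉ Y := fun h => Finset.disjoint_left.1 hYA h haA
  refine ⟨_, hXY.tail (jumpStep_swap (isIndepSet_of_disjoint hB hYA) huY haY ?_
    (adj_or_exists_of_mem_movable hA hB haA hum)), mem_insert_self _ _⟩
  refine isIndepSet_of_unique hB (a := a) (fun v hv hvA => ?_) (fun v hv hav => ?_)
  · rcases mem_insert.1 hv with h | hv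
    · exact h
    · exact absurd hvA (Finset.disjoint_left.1 hYA (mem_erase.1 hv).2)
  · rcases mem_insert.1 hv with rfl | hv
    · exact G.loopless.irrefl _ hav
    · obtain ⟨hvu, hvY⟩ := mem_erase.1 hv
      exact hvu (hu v hvY (mem_outerNbrs.2 ⟨Finset.disjoint_left.1 hYA hvY, hav⟩))

include hA hB in
/-- A token on `a` makes the other tokens freely movable: it jumps to the target of another token,
which then jumps to `a`. -/
theorem reconfigurable_of_mem {X Y : Finset V} (hX : G.IsIndepSet (X : Set V))
    (hY : G.IsIndepSet (Y : Set V)) {a : V} (haA : a ∈ A) (haX : a ∈ X) (haY : a ∈ Y)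
    (hXY : #X = #Y) (hF : X ∩ frozen G A = Y ∩ frozen G A) : Reconfigurable G 2 X Y := by
  induction hm : #(X \ Y) generalizing X with
  | zero =>
    rw [card_eq_zero, sdiff_eq_empty_iff_subset] at hm
    rw [eq_of_subset_of_card_le hm hXY.ge]
    exact .refl
  | succ m ih =>
    obtain ⟨u, hu⟩ := card_pos.1 (by omega : 0 < #(X \ Y))
    obtain ⟨v, hv⟩ := card_pos.1 (by rw [card_sdiff_comm hXY.symm]; omega : 0 < #(Y \ X))
    obtain ⟨huX, huY⟩ := mem_sdiff.1 hu
    obtain ⟨hvY, hvX⟩ := mem_sdiff.1 hv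
    have hau : u ≠ a := fun h => huY (h ▸ haY)
    have hav : v ≠ a := fun h => hvX (h ▸ haX)
    have huA : u ∉ A := fun h => hau (eq_of_mem_of_isIndepSet hA hX huX haX h haA)
    have hvA : v ∉ A := fun h => hav (eq_of_mem_of_isIndepSet hA hY hvY haY h haA)
    have hFu : u ∉ frozen G A := fun h => huY (mem_inter.1 (hF ▸ mem_inter.2 ⟨huX, h⟩)).1
    have hFv : v ∉ frozen G A := fun h => hvX (mem_inter.1 (hF.symm ▸ mem_inter.2 ⟨hvY, h⟩)).1
    have hum : u ∈ movable G A := by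
      simp only [mem_frozen, not_and, not_forall, not_not] at hFu
      exact mem_movable.2 ⟨huA, hFu huA⟩
    have hvm : v ∈ movable G A := by
      simp only [mem_frozen, not_and, not_forall, not_not] at hFv
      exact mem_movable.2 ⟨hvA, hFv hvA⟩
    have hd := (enters_of_jump_out hA hX haX haA hvA).1
    have h1 := jumpStep_swap (G := G) hX haX hvX (isIndepSet_of_disjoint hB hd) (by
      rcases adj_or_exists_of_mem_movable hA hB haA hvm with h | h | ⟨w, h, h'⟩
      · exact Or.inl h.symm
      · exact Or.inr (Or.inl h.symm)
      · exact Or.inr (Or.inr ⟨w, h'.symm, h.symm⟩))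
    have he : insert a ((insert v (X.erase a)).erase u) = insert v (X.erase u) :=
      insert_erase_insert_erase haX hau fun h => huY (h ▸ hvY)
    have hI : G.IsIndepSet (insert v (X.erase u) : Finset V) := by
      refine isIndepSet_of_unique hB (a := a) (fun w hw hwA => ?_) (fun w hw haw => ?_)
      · rcases mem_insert.1 hw with rfl | hw
        · exact absurd hwA hvA
        · exact eq_of_mem_of_isIndepSet hA hX (mem_erase.1 hw).2 haX hwA haA
      · rcases mem_insert.1 hw with rfl | hw
        · exact hY haY hvY hav.symm haw
        · exact hX haX (mem_erase.1 hw).2 haw.ne haw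
    have h2 := jumpStep_swap (G := G) (X := insert v (X.erase a)) (u := u) (v := a)
      (isIndepSet_of_disjoint hB hd) (by simp [hau, huX]) (by simp [hav.symm]) (he ▸ hI)
      (adj_or_exists_of_mem_movable hA hB haA hum)
    rw [he] at h2
    refine .head h1 (.head h2 (ih hI (by simp [haX, hau.symm])
      ((card_insert_erase huX hvX).trans hXY) ?_ ?_))
    · rw [← hF, insert_inter_of_notMem hFv, erase_inter, erase_eq_of_notMem]
      exact fun h => hFu (mem_inter.1 h).2
    · rw [insert_erase_sdiff hvY, card_erase_of_mem hu, hm, Nat.add_sub_cancel]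

/-- Linked vertices `a` and `b`, the second of which has a neighbour outside `A`, leave room for
`k` tokens outside `A` such that a token can enter both at `a` and at `b`. -/
theorem exists_card_eq_of_linked {k : ℕ} {a b : V} (h : Linked G A k a b)
    (hb : (outerNbrs G A b).Nonempty) :
    ∃ U ⊆ movable G A, #U = k ∧
      #(U ∩ outerComp G A a) + #(outerNbrs G A a) ≤ #(outerComp G A a) + 1 ∧
      #(U ∩ outerComp G A b) + #(outerNbrs G A b) ≤ #(outerComp G A b) + 1 := by
  obtain ⟨⟨haA, ha⟩, ⟨hbA, hb'⟩, hab⟩ := h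
  have hb0 := card_pos.2 hb
  have hNa := outerNbrs_subset_outerComp (G := G) (A := A) a
  have hNb := outerNbrs_subset_outerComp (G := G) (A := A) b
  have hKa := outerComp_subset_movable (G := G) haA
  have hKb := outerComp_subset_movable (G := G) hbA
  -- All but one of the neighbours of `a` and of `b` are kept free.
  obtain ⟨P, hPs, hP⟩ := exists_subset_card_eq (Nat.sub_le #(outerNbrs G A a) 1)
  obtain ⟨Q, hQs, hQ⟩ := exists_subset_card_eq (Nat.sub_le #(outerNbrs G A b) 1)
  have room : ∀ S K U : Finset V, S ⊆ K → U ∩ S = ∅ → #(U ∩ K) + #S ≤ #K := by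
    intro S K U hSK hUS
    have h1 : U ∩ K ⊆ K \ S := by
      intro x hx
      have : x ∉ U ∩ S := by simp [hUS]
      grind
    have h2 := card_le_card h1
    have h3 := card_sdiff_add_card_eq_card hSK
    omega
  have choose : ∀ S ⊆ movable G A, k + #S ≤ #(movable G A) →
      ∃ U ⊆ movable G A, #U = k ∧ U ∩ S = ∅ := by
    intro S hS hk
    have h3 := card_sdiff_add_card_eq_card hS
    obtain ⟨U, hU, hUk⟩ := exists_subset_card_eq (by omega : k ≤ #(movable G A \ S))
    refine ⟨U, hU.trans sdiff_subset, hUk, ?_⟩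
    ext x
    have := @hU x
    grind
  have hcase : (crossGraph G A).Reachable a b ∨
      k + #(P ∪ Q) ≤ #(movable G A) := by
    refine hab.imp_right fun h => ?_
    have := card_union_le P Q
    omega
  rcases hcase with hr | hk
  · have hK : outerComp G A a = outerComp G A b := by
      ext x
      simp only [mem_outerComp]
      exact ⟨fun h => ⟨h.1, hr.symm.trans h.2⟩, fun h => ⟨h.1, hr.trans h.2⟩⟩
    rcases le_total #(outerNbrs G A a) #(outerNbrs G A b) with hle | hle
    · obtain ⟨U, hU, hUk, hUS⟩ := choose Q ((hQs.trans hNb).trans hKb) (by omega)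
      have := room Q _ U (hQs.trans hNb) hUS
      exact ⟨U, hU, hUk, by rw [hK]; omega, by omega⟩
    · obtain ⟨U, hU, hUk, hUS⟩ := choose P ((hPs.trans hNa).trans hKa) (by omega)
      have := room P _ U (hPs.trans hNa) hUS
      exact ⟨U, hU, hUk, by omega, by rw [← hK]; omega⟩
  · obtain ⟨U, hU, hUk, hUS⟩ := choose (P ∪ Q)
      (union_subset ((hPs.trans hNa).trans hKa) ((hQs.trans hNb).trans hKb)) hk
    rw [inter_union_distrib_left, union_eq_empty] at hUS
    have h1 := room P _ U (hPs.trans hNa) hUS.1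
    have h2 := room Q _ U (hQs.trans hNb) hUS.2
    exact ⟨U, hU, hUk, by omega, by omega⟩

include hA hB in
theorem exists_reconfigurable_of_linked {X : Finset V} (hX : G.IsIndepSet (X : Set V)) {a b : V}
    (ha : a ∈ X) (h : Linked G A #(X \ frozen G A) a b) :
    ∃ Y, Reconfigurable G 2 X Y ∧ b ∈ Y := by
  obtain ⟨⟨haA, -⟩, ⟨hbA, -⟩, -⟩ := id h
  by_cases hN : (outerNbrs G A b).Nonempty
  · obtain ⟨U, hU, hUk, hUa, hUb⟩ := exists_card_eq_of_linked h hN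
    have haF : a ∉ frozen G A := fun h => (mem_frozen.1 h).1 haA
    have hUF : Disjoint (X ∩ frozen G A) U := by
      rw [Finset.disjoint_left]
      intro x hx hxU
      obtain ⟨-, w, hw⟩ := mem_movable.1 (hU hxU)
      exact (mem_frozen.1 (mem_inter.1 hx).2).2 w hw
    have hZA : Disjoint (X ∩ frozen G A ∪ U) A := by
      rw [Finset.disjoint_left]
      intro x hx
      rcases mem_union.1 hx with hx | hx
      · exact (mem_frozen.1 (mem_inter.1 hx).2).1
      · exact (mem_movable.1 (hU hx)).1
    have hZF : X ∩ frozen G A = (X ∩ frozen G A ∪ U) ∩ frozen G A := by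
      ext x
      have h1 : x ∈ U → x ∉ frozen G A := fun hx hF => by
        obtain ⟨-, w, hw⟩ := mem_movable.1 (hU hx)
        exact (mem_frozen.1 hF).2 w hw
      grind
    have hZc : #X = #(X ∩ frozen G A ∪ U) := by
      rw [card_union_of_disjoint hUF, hUk, ← card_sdiff_add_card_inter X (frozen G A), add_comm]
    have hZ := isIndepSet_of_disjoint hB hZA
    have hZn : ((X ∩ frozen G A ∪ U) \ frozen G A).Nonempty := by
      rw [← card_pos, ← card_sdiff_eq hZc hZF]
      exact card_pos.2 ⟨a, mem_sdiff.2 ⟨ha, haF⟩⟩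
    have hZK : ∀ c ∈ A, (X ∩ frozen G A ∪ U) ∩ outerComp G A c = U ∩ outerComp G A c := by
      intro c hc
      ext x
      have h1 : x ∈ outerComp G A c → x ∉ frozen G A := fun hx hF => by
        obtain ⟨-, w, hw⟩ := mem_movable.1 (outerComp_subset_movable hc hx)
        exact (mem_frozen.1 hF).2 w hw
      grind
    obtain ⟨Y, hZY, haY⟩ := exists_reconfigurable_mem hA hB (a := a) hZn
      ⟨haA, Or.inr ⟨hZA, by rwa [hZK a haA]⟩⟩
    obtain ⟨Y', hZY', hbY'⟩ := exists_reconfigurable_mem hA hB (a := b) hZn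
      ⟨hbA, Or.inr ⟨hZA, by rwa [hZK b hbA]⟩⟩
    obtain ⟨h1, h2⟩ := card_eq_and_inter_frozen hA hB hZY
    have hXY := reconfigurable_of_mem hA hB hX (isIndepSet_of_reconfigurable hZ hZY) haA ha haY
      (hZc.trans h1) (hZF.trans h2)
    exact ⟨Y', (hXY.trans (reconfigurable_symm hZY)).trans hZY', hbY'⟩
  · by_cases hab : a = b
    · exact ⟨X, .refl, hab ▸ ha⟩
    have hb : b ∉ X := fun h => hab (eq_of_mem_of_isIndepSet hA hX ha h haA hbA)
    refine ⟨_, .single (jumpStep_swap hX ha hb ?_ (Or.inr (Or.inl (hA haA hbA hab)))),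
      mem_insert_self _ _⟩
    have huniq : ∀ v ∈ insert b (X.erase a), v ∈ A → v = b := by
      intro v hv hvA
      rcases mem_insert.1 hv with h | hv
      · exact h
      · exact absurd (eq_of_mem_of_isIndepSet hA hX (mem_erase.1 hv).2 ha hvA haA)
          (mem_erase.1 hv).1
    refine isIndepSet_of_unique hB huniq fun v hv hbv => ?_
    by_cases hvA : v ∈ A
    · exact hbv.ne (huniq v hv hvA).symm
    · exact hN ⟨v, mem_outerNbrs.2 ⟨hvA, hbv⟩⟩

include hA hB in
theorem reconfigurable_of_criterion {X Y : Finset V} (hX : G.IsIndepSet (X : Set V))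
    (hY : G.IsIndepSet (Y : Set V)) (h : Criterion G A X Y) : Reconfigurable G 2 X Y := by
  obtain ⟨hc, hF, ⟨hXA, hYA, h⟩ | ⟨a, b, ha, hb, hab⟩⟩ := h
  · exact reconfigurable_of_card_inter_eq hB hXA hc h
  by_cases hk : (X \ frozen G A).Nonempty
  · have hk' : (Y \ frozen G A).Nonempty := by
      rwa [← card_pos, ← card_sdiff_eq hc hF, card_pos]
    obtain ⟨X', hXX', haX'⟩ := exists_reconfigurable_mem hA hB hk ha
    obtain ⟨Y', hYY', hbY'⟩ := exists_reconfigurable_mem hA hB hk' hb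
    obtain ⟨X'', hXX'', hbX''⟩ : ∃ X'', Reconfigurable G 2 X X'' ∧ b ∈ X'' := by
      clear hb hbY'
      induction hab with
      | refl => exact ⟨X', hXX', haX'⟩
      | tail _ h ih =>
        obtain ⟨Z, hXZ, hZ⟩ := ih
        obtain ⟨h1, h2⟩ := card_eq_and_inter_frozen hA hB hXZ
        rw [card_sdiff_eq h1 h2] at h
        obtain ⟨Z', hZZ', hZ'⟩ := exists_reconfigurable_of_linked hA hB
          (isIndepSet_of_reconfigurable hX hXZ) hZ h
        exact ⟨Z', hXZ.trans hZZ', hZ'⟩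
    obtain ⟨h1, h2⟩ := card_eq_and_inter_frozen hA hB hXX''
    obtain ⟨h3, h4⟩ := card_eq_and_inter_frozen hA hB hYY'
    exact (hXX''.trans (reconfigurable_of_mem hA hB (isIndepSet_of_reconfigurable hX hXX'')
      (isIndepSet_of_reconfigurable hY hYY') hb.1 hbX'' hbY' (by omega)
      (by rw [← h2, hF, h4]))).trans (reconfigurable_symm hYY')
  · -- All tokens are frozen.
    rw [not_nonempty_iff_eq_empty, sdiff_eq_empty_iff_subset] at hk
    have hXY : X ⊆ Y := by
      rw [← inter_eq_left.2 hk, hF]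
      exact inter_subset_left
    rw [eq_of_subset_of_card_le hXY hc.ge]
    exact .refl

include hA hB in
theorem reconfigurable_iff_criterion {X Y : Finset V} (hX : G.IsIndepSet (X : Set V))
    (hY : G.IsIndepSet (Y : Set V)) : Reconfigurable G 2 X Y ↔ Criterion G A X Y :=
  ⟨criterion_of_reconfigurable hA hB, reconfigurable_of_criterion hA hB hX hY⟩

end Partition

/-! ### Finding a split partition by degrees -/

open Classical in
/-- The degree of a vertex, as a number of vertices. -/
noncomputable def deg (G : SimpleGraph V) (u : V) : ℕ := #{w | G.Adj u w}

open Classical in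
/-- The vertices of degree greater than `d`, and the vertex `v`. -/
noncomputable def degSet (G : SimpleGraph V) (d : ℕ) (v : V) : Finset V := {u | d < deg G u ∨ u = v}

/-- The set `A` is a clique with independent complement. -/
def IsSplitSet (G : SimpleGraph V) (A : Finset V) : Prop :=
  G.IsClique (A : Set V) ∧ G.IsIndepSet ((A : Set V)ᶜ)

/-- In a split graph, a largest clique with independent complement consists of the vertices whose
degree exceeds a threshold and at most one further vertex. -/
theorem exists_isSplitSet_degSet [Nonempty V] (hG : G.IsSplit) :
    ∃ d < Fintype.card V, ∃ v, IsSplitSet G (degSet G d v) := by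
  classical
  obtain ⟨A₀, hA₀, hB₀⟩ := hG
  obtain ⟨A, hAs, hmax⟩ := exists_max_image ({A | IsSplitSet G A} : Finset (Finset V)) card
    ⟨A₀.toFinset, mem_filter.2 ⟨mem_univ _, by rw [IsSplitSet, Set.coe_toFinset]; exact ⟨hA₀, hB₀⟩⟩⟩
  simp only [mem_filter, mem_univ, true_and] at hAs hmax
  obtain ⟨hA, hB⟩ := id hAs
  have hne : A.Nonempty := by
    by_contra hne
    rw [not_nonempty_iff_eq_empty] at hne
    obtain ⟨v⟩ := ‹Nonempty V›
    have h1 := hmax {v} ⟨by simp, fun x _ y _ h => hB (by simp [hne]) (by simp [hne]) h⟩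
    simp [hne] at h1
  have hnb : ∀ b ∉ A, (({w | G.Adj b w} : Finset V) ⊆ A) := fun b hb w hw =>
    mem_of_adj hB hb (by simpa using hw)
  have hb : ∀ b ∉ A, deg G b < #A := by
    intro b hb
    refine lt_of_le_of_ne (card_le_card (hnb b hb)) fun h => ?_
    have h1 := eq_of_subset_of_card_le (hnb b hb) h.ge
    have h2 := hmax (insert b A) ⟨by
        rw [coe_insert, SimpleGraph.isClique_insert]
        refine ⟨hA, fun a ha _ => ?_⟩
        have h3 : a ∈ ({w | G.Adj b w} : Finset V) := by rw [h1]; exact ha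
        simpa using h3, fun x hx y hy h => hB (fun h' => hx (by simp [show x ∈ A from h']))
          (fun h' => hy (by simp [show y ∈ A from h'])) h⟩
    rw [card_insert_of_notMem hb] at h2
    omega
  have herase : ∀ a ∈ A, A.erase a ⊆ ({w | G.Adj a w} : Finset V) := by
    intro a ha w hw
    obtain ⟨hwa, hw⟩ := mem_erase.1 hw
    simpa using hA ha hw hwa.symm
  have ha : ∀ a ∈ A, #A ≤ deg G a + 1 := by
    intro a ha
    have h1 := card_le_card (herase a ha)
    rw [card_erase_of_mem ha] at h1
    unfold deg
    omega
  have hpos := card_pos.2 hne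
  have hle := card_le_univ A
  -- A vertex of `A` of the least possible degree has no neighbours outside `A`.
  have hmin : ∀ a ∈ A, deg G a < #A → ∀ b ∉ A, ¬ G.Adj b a := by
    intro a haA hlt b hbA hadj
    have h1 := eq_of_subset_of_card_le (herase a haA) (by
      rw [card_erase_of_mem haA]; unfold deg at hlt; omega)
    have h2 : b ∈ A.erase a := by rw [h1]; simpa using hadj.symm
    exact hbA (mem_erase.1 h2).2
  by_cases htwo : ∃ a ∈ A, ∃ a' ∈ A, a ≠ a' ∧ deg G a < #A ∧ deg G a' < #A
  · obtain ⟨a, haA, a', haA', haa', hda, hda'⟩ := htwo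
    have hb2 : ∀ b ∉ A, deg G b + 2 ≤ #A := by
      intro b hbA
      have h1 : ({w | G.Adj b w} : Finset V) ⊆ (A.erase a).erase a' := by
        intro w hw
        have hw' : G.Adj b w := by simpa using hw
        refine mem_erase.2 ⟨?_, mem_erase.2 ⟨?_, hnb b hbA hw⟩⟩
        · rintro rfl; exact hmin w haA' hda' b hbA hw'
        · rintro rfl; exact hmin w haA hda b hbA hw'
      have h2 := card_le_card h1
      have h3 : a' ∈ A.erase a := mem_erase.2 ⟨haa'.symm, haA'⟩
      have h4 := card_pos.2 ⟨a', h3⟩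
      rw [card_erase_of_mem h3] at h2
      rw [card_erase_of_mem haA] at h2 h4
      unfold deg
      omega
    have h2 := card_pair haa'
    have h3 : #({a, a'} : Finset V) ≤ #A := card_le_card (by intro x; simp; grind)
    refine ⟨#A - 2, by omega, a, ?_⟩
    convert hAs
    ext u
    simp only [degSet, mem_filter, mem_univ, true_and]
    refine ⟨fun h => ?_, fun hu => Or.inl (by have := ha u hu; omega)⟩
    by_contra hu
    rcases h with h | rfl
    · have := hb2 u hu
      omega
    · exact hu haA
  · obtain ⟨v, hvA, hv⟩ : ∃ v ∈ A, ∀ a ∈ A, deg G a < #A → a = v := by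
      by_cases hex : ∃ v ∈ A, deg G v < #A
      · obtain ⟨v, hvA, hv⟩ := hex
        exact ⟨v, hvA, fun a haA hda => by_contra fun hav =>
          htwo ⟨a, haA, v, hvA, hav, hda, hv⟩⟩
      · obtain ⟨v, hvA⟩ := hne
        exact ⟨v, hvA, fun a haA hda => absurd ⟨a, haA, hda⟩ hex⟩
    refine ⟨#A - 1, by omega, v, ?_⟩
    convert hAs
    ext u
    simp only [degSet, mem_filter, mem_univ, true_and]
    refine ⟨fun h => ?_, fun hu => ?_⟩
    · by_contra hu
      rcases h with h | rfl
      · have := hb u hu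
        omega
      · exact hu hvA
    · by_cases hd : deg G u < #A
      · exact Or.inr (hv u hu hd)
      · exact Or.inl (by omega)

end SplitReconf

/-! ### Logical and counting operations on terms -/

namespace RAM

/-- A number regarded as a truth value. -/
def Truth (k : ℕ) : Prop := k ≠ 0

namespace CountTerm

/-- Negation. -/
def not (t : CountTerm) : CountTerm := sub (const 1) t

/-- Disjunction. -/
def or (t u : CountTerm) : CountTerm := add t u

/-- Conjunction. -/
def and (t u : CountTerm) : CountTerm := not (or (not t) (not u))

/-- Implication. -/
def imp (t u : CountTerm) : CountTerm := or (not t) u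

/-- The term `t < u`. -/
def lt (t u : CountTerm) : CountTerm := sub u t

/-- The term `t ≤ u`. -/
def le (t u : CountTerm) : CountTerm := not (lt u t)

/-- The term `t = u`. -/
def eq (t u : CountTerm) : CountTerm := and (le t u) (le u t)

/-- The term `∃ x < n, t`. -/
def ex (x : ℕ) (t : CountTerm) : CountTerm := sum x t

/-- The term `∀ x < n, t`. -/
def all (x : ℕ) (t : CountTerm) : CountTerm := not (ex x (not t))

/-- The number of `x < n` such that `t`.  The double negation turns truth values into `0` and
`1`. -/
def count (x : ℕ) (t : CountTerm) : CountTerm := sum x (not (not t))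

/-- The index of the entry of an `n × n` matrix in row and column given by the registers `x` and
`y`.  Register `9` counts the summands of the product `x * n`. -/
def index (x y : ℕ) : CountTerm := add (sum 9 (reg x)) (reg y)

/-- The entry of the matrix stored in array `a`. -/
def cell (a x y : ℕ) : CountTerm := arr a (index x y)

/-- Membership in the set stored in array `a`. -/
def mem (a x : ℕ) : CountTerm := arr a (reg x)

variable {s : State} {t u : CountTerm} {n x : ℕ}

@[simp] theorem truth_not : Truth ((not t).eval s) ↔ ¬ Truth (t.eval s) := by
  simp only [not, eval, Truth]; omega

@[simp] theorem truth_or : Truth ((or t u).eval s) ↔ Truth (t.eval s) ∨ Truth (u.eval s) := by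
  simp only [or, eval, Truth]; omega

@[simp] theorem truth_and : Truth ((and t u).eval s) ↔ Truth (t.eval s) ∧ Truth (u.eval s) := by
  simp only [and, truth_not, truth_or]; tauto

@[simp] theorem truth_imp : Truth ((imp t u).eval s) ↔ (Truth (t.eval s) → Truth (u.eval s)) := by
  simp only [imp, truth_not, truth_or]; tauto

@[simp] theorem truth_lt : Truth ((lt t u).eval s) ↔ t.eval s < u.eval s := by
  simp only [lt, eval, Truth]; omega

@[simp] theorem truth_le : Truth ((le t u).eval s) ↔ t.eval s ≤ u.eval s := by
  simp only [le, truth_not, truth_lt, not_lt]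

@[simp] theorem truth_eq : Truth ((eq t u).eval s) ↔ t.eval s = u.eval s := by
  simp only [eq, truth_and, truth_le]; omega

theorem truth_ex (hs : s.reg 0 = n) :
    Truth ((ex x t).eval s) ↔ ∃ i : Fin n, Truth (t.eval (s.setReg x i)) := by
  simp only [ex, eval, Truth, hs, ne_eq, Finset.sum_eq_zero_iff, Finset.mem_range, not_forall,
    Fin.exists_iff]

theorem truth_all (hs : s.reg 0 = n) :
    Truth ((all x t).eval s) ↔ ∀ i : Fin n, Truth (t.eval (s.setReg x i)) := by
  simp only [all, truth_not, truth_ex hs, not_exists, not_not]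

open Classical in
theorem eval_count (hs : s.reg 0 = n) :
    (count x t).eval s =
      (Finset.univ.filter fun i : Fin n => Truth (t.eval (s.setReg x i))).card := by
  have h : ∀ s' : State, (not (not t)).eval s' = if Truth (t.eval s') then 1 else 0 := by
    intro s'
    split_ifs with h <;> simp only [not, eval, Truth] at * <;> omega
  simp only [count, eval, h, hs, Finset.card_filter]
  exact Finset.sum_range fun i => if Truth (t.eval (s.setReg x i)) then 1 else 0

theorem eval_index {y : ℕ} (hx : x ≠ 9) :
    (index x y).eval s = s.reg x * s.reg 0 + s.reg y := by
  simp [index, eval, hx, mul_comm]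

theorem eval_cell {a y : ℕ} (hx : x ≠ 9) :
    (cell a x y).eval s = s.arr a (s.reg x * s.reg 0 + s.reg y) := by
  rw [cell, eval, eval_index hx]

@[simp] theorem eval_mem {a : ℕ} : (mem a x).eval s = s.arr a (s.reg x) := rfl

@[simp] theorem eval_reg : (reg x).eval s = s.reg x := rfl

@[simp] theorem eval_const {c : ℕ} : (const c).eval s = c := rfl

@[simp] theorem eval_add : (add t u).eval s = t.eval s + u.eval s := rfl

end CountTerm

/-! ### Tables and transitive closure -/

namespace Command

open CountTerm

theorem run_loop_induction {x : ℕ} {c : Command} {s : State} (I : ℕ → State → Prop) (h0 : I 0 s)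
    (hstep : ∀ i < s.reg 0, ∀ s', I i s' → I (i + 1) (c.run (s'.setReg x i))) :
    I (s.reg 0) ((loop x c).run s) := by
  suffices H : ∀ m ≤ s.reg 0,
      I m ((List.range m).foldl (fun s' i => c.run (s'.setReg x i)) s) from H _ le_rfl
  intro m hm
  induction m with
  | zero => exact h0
  | succ m ih =>
    rw [List.range_succ, List.foldl_append]
    exact hstep m hm _ (ih (by omega))

/-- Tabulation of the set of all `i < n` satisfying `t`, where register `1` holds `i`. -/
def tabulateSet (a : ℕ) (t : CountTerm) : Command := loop 1 (store a (reg 1) t)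

/-- Tabulation of the binary relation `t` on the numbers below `n`; registers `1` and `2` hold the
arguments. -/
def tabulateRel (a : ℕ) (t : CountTerm) : Command := loop 1 (loop 2 (store a (index 1 2) t))

theorem tabulateSet_spec {n : ℕ} {s : State} (hs : s.reg 0 = n) {a : ℕ} {t : CountTerm}
    {p : Fin n → Prop}
    (h : ∀ (s' : State) (u : Fin n), s'.reg 0 = n → (∀ b ≠ a, s'.arr b = s.arr b) → s'.reg 1 = u →
      (Truth (t.eval s') ↔ p u)) :
    ((tabulateSet a t).run s).reg 0 = n ∧
      (∀ b ≠ a, ((tabulateSet a t).run s).arr b = s.arr b) ∧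
      ∀ u : Fin n, Truth (((tabulateSet a t).run s).arr a u) ↔ p u := by
  have key := run_loop_induction (x := 1) (c := store a (reg 1) t) (s := s)
    (fun i s' => s'.reg 0 = n ∧ (∀ b ≠ a, s'.arr b = s.arr b) ∧
      ∀ u : Fin n, u.val < i → (Truth (s'.arr a u) ↔ p u))
    ⟨hs, fun _ _ => rfl, fun u hu => absurd hu (Nat.not_lt_zero _)⟩
    (by
      rintro i hi s' ⟨h1, h2, h3⟩
      rw [hs] at hi
      refine ⟨by simp [run, h1], fun b hb => ?_, fun u hu => ?_⟩
      · ext j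
        simp [run, State.setArr_arr, hb, h2 b hb]
      · rcases Nat.lt_succ_iff_lt_or_eq.1 hu with hu | hu
        · simpa [run, State.setArr_arr, hu.ne] using h3 u hu
        · simpa [run, State.setArr_arr, hu] using
            h (s'.setReg 1 i) u (by simpa using h1) h2 (by simp [hu]))
  rw [hs] at key
  exact ⟨key.1, key.2.1, fun u => key.2.2 u u.isLt⟩

theorem index_inj {n u v u' v' : ℕ} (hv : v < n) (hv' : v' < n) :
    u * n + v = u' * n + v' ↔ u = u' ∧ v = v' := by
  refine ⟨fun h => ?_, fun h => by rw [h.1, h.2]⟩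
  have hn : 0 < n := Nat.zero_lt_of_lt hv
  have h1 := congrArg (· / n) h
  simp only [mul_comm _ n, Nat.mul_add_div hn, Nat.div_eq_of_lt hv, Nat.div_eq_of_lt hv',
    add_zero] at h1
  subst h1
  exact ⟨rfl, Nat.add_left_cancel h⟩

theorem tabulateRel_spec {n : ℕ} {s : State} (hs : s.reg 0 = n) {a : ℕ} {t : CountTerm}
    {r : Fin n → Fin n → Prop}
    (h : ∀ (s' : State) (u v : Fin n), s'.reg 0 = n → (∀ b ≠ a, s'.arr b = s.arr b) →
      s'.reg 1 = u → s'.reg 2 = v → (Truth (t.eval s') ↔ r u v)) :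
    ((tabulateRel a t).run s).reg 0 = n ∧
      (∀ b ≠ a, ((tabulateRel a t).run s).arr b = s.arr b) ∧
      ∀ u v : Fin n, Truth (((tabulateRel a t).run s).arr a (u * n + v)) ↔ r u v := by
  have key := run_loop_induction (x := 1) (c := loop 2 (store a (index 1 2) t)) (s := s)
    (fun i s' => s'.reg 0 = n ∧ (∀ b ≠ a, s'.arr b = s.arr b) ∧
      ∀ u v : Fin n, u.val < i → (Truth (s'.arr a (u * n + v)) ↔ r u v))
    ⟨hs, fun _ _ => rfl, fun u _ hu => absurd hu (Nat.not_lt_zero _)⟩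
    (by
      rintro i hi s₁ ⟨h1, h2, h3⟩
      rw [hs] at hi
      have key := run_loop_induction (x := 2) (c := store a (index 1 2) t) (s := s₁.setReg 1 i)
        (fun j s' => s'.reg 0 = n ∧ s'.reg 1 = i ∧ (∀ b ≠ a, s'.arr b = s.arr b) ∧
          ∀ u v : Fin n, (u.val < i ∨ u.val = i ∧ v.val < j) →
            (Truth (s'.arr a (u * n + v)) ↔ r u v))
        ⟨by simpa using h1, by simp, h2, fun u v huv => h3 u v (by omega)⟩
        (by
          rintro j hj s' ⟨h1', h2', h3', h4'⟩
          have hj : j < n := by simpa [h1] using hj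
          have hidx : (index 1 2).eval (s'.setReg 2 j) = i * n + j := by
            rw [eval_index (by decide)]
            simp [h1', h2']
          refine ⟨by simp [run, h1'], by simp [run, h2'], fun b hb => ?_, fun u v huv => ?_⟩
          · ext k
            simp [run, State.setArr_arr, hb, h3' b hb]
          · simp only [run, State.setArr_arr, hidx, true_and, index_inj v.isLt hj,
              State.setReg_arr]
            by_cases heq : u.val = i ∧ v.val = j
            · rw [if_pos heq]
              exact h (s'.setReg 2 j) u v (by simpa using h1') h3' (by simp [h2', heq.1])
                (by simp [heq.2])
            · rw [if_neg heq]
              exact h4' u v (by omega))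
      simp only [State.setReg_reg, if_neg (show (0 : ℕ) ≠ 1 by decide), h1] at key
      exact ⟨key.1, key.2.2.1, fun u v huv => key.2.2.2 u v (by omega)⟩)
  rw [hs] at key
  exact ⟨key.1, key.2.1, fun u v => key.2.2 u v u.isLt⟩

/-- Computes the reflexive transitive closure of the relation in array `e` into array `r`, by `n`
rounds that lengthen paths by one edge.  Array `b` is a buffer. -/
def closure (e r b : ℕ) : Command :=
  seq (tabulateRel r (eq (reg 1) (reg 2)))
    (loop 3 (seq
      (tabulateRel b (or (cell r 1 2) (ex 4 (and (cell r 1 4) (cell e 4 2)))))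
      (tabulateRel r (cell b 1 2))))

/-- One more edge at the end of a path. -/
def extend {α : Type*} (E R : α → α → Prop) (u v : α) : Prop := R u v ∨ ∃ w, R u w ∧ E w v

theorem extend_iterate_iff {n : ℕ} (E : Fin n → Fin n → Prop) (u v : Fin n) :
    (extend E)^[n] (· = ·) u v ↔ Relation.ReflTransGen E u v := by
  classical
  constructor
  · suffices H : ∀ m v, (extend E)^[m] (· = ·) u v → Relation.ReflTransGen E u v from H n v
    intro m
    induction m with
    | zero => rintro v rfl; exact .refl
    | succ m ih =>
      intro v h
      rw [Function.iterate_succ_apply'] at h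
      rcases h with h | ⟨w, h, h'⟩
      · exact ih v h
      · exact (ih w h).tail h'
  · -- As long as the set of vertices reached is not closed, it grows in every round.
    have H : ∀ m, (∀ v, Relation.ReflTransGen E u v → (extend E)^[m] (· = ·) u v) ∨
        m < (Finset.univ.filter fun v => (extend E)^[m] (· = ·) u v).card := by
      intro m
      induction m with
      | zero =>
        right
        exact Finset.card_pos.2 ⟨u, Finset.mem_filter.2 ⟨Finset.mem_univ _, rfl⟩⟩
      | succ m ih =>
        rcases ih with ih | ih
        · left
          intro v h
          rw [Function.iterate_succ_apply']
          exact Or.inl (ih v h)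
        · by_cases hcl : ∀ w v, (extend E)^[m] (· = ·) u w → E w v → (extend E)^[m] (· = ·) u v
          · left
            intro v h
            rw [Function.iterate_succ_apply']
            left
            induction h with
            | refl =>
              obtain ⟨w, hw⟩ := Finset.card_pos.1 (Nat.zero_lt_of_lt ih)
              clear hw ih hcl
              induction m with
              | zero => rfl
              | succ m ih => rw [Function.iterate_succ_apply']; exact Or.inl ih
            | tail _ h ih => exact hcl _ _ ih h
          · right
            push Not at hcl
            obtain ⟨w, v, h1, h2, h3⟩ := hcl
            refine lt_of_le_of_lt ih (Finset.card_lt_card ?_)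
            rw [Finset.ssubset_iff_of_subset]
            · refine ⟨v, ?_, by simpa using h3⟩
              rw [Finset.mem_filter, Function.iterate_succ_apply']
              exact ⟨Finset.mem_univ _, Or.inr ⟨w, h1, h2⟩⟩
            · intro x hx
              rw [Finset.mem_filter] at hx ⊢
              rw [Function.iterate_succ_apply']
              exact ⟨hx.1, Or.inl hx.2⟩
    intro h
    refine (H n).elim (fun H => H v h) fun H => absurd H ?_
    exact not_lt.2 ((Finset.card_le_univ _).trans (Fintype.card_fin n).le)

theorem closure_spec {n : ℕ} {s : State} (hs : s.reg 0 = n) {e r b : ℕ} (her : e ≠ r)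
    (heb : e ≠ b) (hrb : r ≠ b) {E : Fin n → Fin n → Prop}
    (hE : ∀ u v : Fin n, Truth (s.arr e (u * n + v)) ↔ E u v) :
    ((closure e r b).run s).reg 0 = n ∧
      (∀ c, c ≠ r → c ≠ b → ((closure e r b).run s).arr c = s.arr c) ∧
      ∀ u v : Fin n, Truth (((closure e r b).run s).arr r (u * n + v)) ↔
        Relation.ReflTransGen E u v := by
  simp only [closure, run.eq_2]
  obtain ⟨h1, h2, h3⟩ := tabulateRel_spec (n := n) hs (a := r) (t := eq (reg 1) (reg 2))
    (r := fun u v => u = v) (fun s' u v _ _ hu hv => by simp [hu, hv, Fin.ext_iff])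
  set s₁ := (tabulateRel r (eq (reg 1) (reg 2))).run s
  have key := run_loop_induction (x := 3) (s := s₁) (c := (seq
      (tabulateRel b (or (cell r 1 2) (ex 4 (and (cell r 1 4) (cell e 4 2)))))
      (tabulateRel r (cell b 1 2))))
    (fun i s' => s'.reg 0 = n ∧ (∀ c, c ≠ r → c ≠ b → s'.arr c = s.arr c) ∧
      ∀ u v : Fin n, Truth (s'.arr r (u * n + v)) ↔ (extend E)^[i] (· = ·) u v)
    ⟨h1, fun c hc _ => h2 c hc, h3⟩
    (by
      rintro i - s' ⟨h1, h2, h3⟩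
      simp only [run.eq_2]
      obtain ⟨h1', h2', h3'⟩ := tabulateRel_spec (n := n) (s := s'.setReg 3 i) (by simpa using h1)
        (a := b) (t := or (cell r 1 2) (ex 4 (and (cell r 1 4) (cell e 4 2))))
        (r := (extend E)^[i + 1] (· = ·)) (fun s'' u v h0 hf hu hv => by
          have hr : s''.arr r = s'.arr r := hf r hrb
          have he : s''.arr e = s.arr e := (hf e heb).trans (h2 e her heb)
          simp [Function.iterate_succ_apply', extend, truth_ex h0, eval_cell, h0, hu, hv, hr, he,
            h3, hE])
      obtain ⟨h1'', h2'', h3''⟩ := tabulateRel_spec (n := n) h1' (a := r) (t := cell b 1 2)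
        (r := (extend E)^[i + 1] (· = ·)) (fun s'' u v h0 hf hu hv => by
          rw [eval_cell (by decide), h0, hu, hv, hf b hrb.symm, h3'])
      exact ⟨h1'', fun c hc hc' => ((h2'' c hc).trans (h2' c hc')).trans (h2 c hc hc'), h3''⟩)
  rw [h1] at key
  exact ⟨key.1, key.2.1, fun u v => (key.2.2 u v).trans (extend_iterate_iff E u v)⟩

end Command

end RAM

/-! ### The program -/

namespace SplitReconf

open Finset RAM RAM.CountTerm RAM.Command

/-- The degree of the vertex in register `x`. -/
def degTerm (x : ℕ) : CountTerm := count 8 (cell 0 x 8)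

/-- The vertex in register `x` belongs to `degSet G d v`, where registers `d` and `v` hold `d`
and `v`. -/
def degSetTerm (d v x : ℕ) : CountTerm := or (lt (reg d) (degTerm x)) (eq (reg x) (reg v))

/-- Registers `1` and `2` hold `d` and `v` such that `degSet G d v` is a clique with independent
complement. -/
def splitTerm : CountTerm :=
  all 3 (all 4 (and
    (imp (and (degSetTerm 1 2 3) (degSetTerm 1 2 4)) (or (eq (reg 3) (reg 4)) (cell 0 3 4)))
    (imp (and (not (degSetTerm 1 2 3)) (not (degSetTerm 1 2 4))) (not (cell 0 3 4)))))

/-- The vertex in register `1` belongs to the set `degSet G d v` for the lexicographically least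
pair `(d, v)` in the table of array `9`. -/
def cliqueTerm : CountTerm :=
  ex 3 (ex 4 (and (cell 9 3 4) (and
    (all 5 (all 6 (imp (cell 9 5 6) (le (index 3 4) (index 5 6)))))
    (degSetTerm 3 4 1))))

/-- The vertices in registers `1` and `2` are adjacent in `crossGraph G A`. -/
def crossTerm : CountTerm := and (cell 0 1 2) (not (and (mem 3 1) (mem 3 2)))

/-- The vertex in register `x` is in `frozen G A`. -/
def frozenTerm (x : ℕ) : CountTerm := and (not (mem 3 x)) (not (ex 8 (cell 0 x 8)))

/-- The size of `movable G A`. -/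
def movableCard : CountTerm := count 7 (and (not (mem 3 7)) (ex 8 (cell 0 7 8)))

/-- The number of tokens of the set in array `a` that are not frozen. -/
def tokensCard (a : ℕ) : CountTerm := count 7 (and (mem a 7) (not (frozenTerm 7)))

/-- The size of `outerNbrs G A u`, for the vertex `u` in register `x`. -/
def outerNbrsCard (x : ℕ) : CountTerm := count 7 (and (not (mem 3 7)) (cell 0 x 7))

/-- The size of `outerComp G A u`, for the vertex `u` in register `x`. -/
def outerCompCard (x : ℕ) : CountTerm := count 7 (and (not (mem 3 7)) (cell 5 x 7))

/-- The number of tokens of the set in array `a` on `outerComp G A u`, for the vertex `u` in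
register `x`. -/
def tokensCompCard (a x : ℕ) : CountTerm :=
  count 7 (and (mem a 7) (and (not (mem 3 7)) (cell 5 x 7)))

/-- The set in array `a` avoids `A`. -/
def disjointTerm (a : ℕ) : CountTerm := all 7 (imp (mem a 7) (not (mem 3 7)))

/-- The condition `Enters G A X u` for the set `X` in array `a` and the vertex `u` in
register `x`. -/
def entersTerm (a x : ℕ) : CountTerm :=
  and (mem 3 x) (or (mem a x) (and (disjointTerm a)
    (le (add (tokensCompCard a x) (outerNbrsCard x)) (add (outerCompCard x) (const 1)))))

/-- The condition on a single vertex, in register `x`, in the definition of `Linked`. -/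
def roomTerm (x : ℕ) : CountTerm :=
  and (mem 3 x) (le (add (tokensCard 1) (outerNbrsCard x)) (add movableCard (const 1)))

/-- The vertices in registers `1` and `2` are linked. -/
def linkedTerm : CountTerm :=
  and (roomTerm 1) (and (roomTerm 2) (or (cell 5 1 2)
    (le (add (add (tokensCard 1) (outerNbrsCard 1)) (outerNbrsCard 2))
      (add movableCard (const 2)))))

/-- The criterion for the sets in arrays `1` and `2`. -/
def criterionTerm : CountTerm :=
  and (eq (count 7 (mem 1 7)) (count 7 (mem 2 7)))
    (and (all 6 (imp (frozenTerm 6) (and (imp (mem 1 6) (mem 2 6)) (imp (mem 2 6) (mem 1 6)))))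
      (or (and (disjointTerm 1) (and (disjointTerm 2)
          (all 6 (eq (tokensCompCard 1 6) (tokensCompCard 2 6)))))
        (ex 1 (ex 2 (and (entersTerm 1 1) (and (entersTerm 2 2) (cell 8 1 2)))))))

/-- The tables that the criterion needs.  Array `9` holds the pairs that give split sets, array `3`
a split set `A`, arrays `4` and `5` the adjacency and the reachability in `crossGraph G A`, arrays
`7` and `8` the links and their closure; array `6` is a buffer. -/
def tables : Command :=
  seq (tabulateRel 9 splitTerm) (seq (tabulateSet 3 cliqueTerm) (seq (tabulateRel 4 crossTerm)
    (seq (closure 4 5 6) (seq (tabulateRel 7 linkedTerm) (closure 7 8 6)))))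

/-- The program that decides reconfigurability in split graphs.  Registers from `10` on are scratch
space.  The double negation turns the truth value into `0` or `1`. -/
def decider : Program :=
  .seq (tables.compile 10) (.seq ((not (not criterionTerm)).compile 10) (.assign 0 (.reg 10)))

/-! ### Correctness of the tables -/

variable {n : ℕ} {G : SimpleGraph (Fin n)} {Is It A : Finset (Fin n)} {s : State}

/-- The arrays `m` hold the graph in array `0` and the token sets in arrays `1` and `2`. -/
structure HasInput (m : ℕ → ℕ → ℕ) (G : SimpleGraph (Fin n)) (Is It : Finset (Fin n)) :
    Prop where
  adj : ∀ u v : Fin n, Truth (m 0 (u * n + v)) ↔ G.Adj u v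
  source : ∀ u : Fin n, Truth (m 1 u) ↔ u ∈ Is
  target : ∀ u : Fin n, Truth (m 2 u) ↔ u ∈ It

theorem HasInput.congr {m m' : ℕ → ℕ → ℕ} (h : HasInput m G Is It) (h' : ∀ a < 3, m' a = m a) :
    HasInput m' G Is It := by
  constructor
  · rw [h' 0 (by decide)]; exact h.adj
  · rw [h' 1 (by decide)]; exact h.source
  · rw [h' 2 (by decide)]; exact h.target

/-- In addition, array `3` holds `A` and array `5` the reachability in `crossGraph G A`. -/
structure HasReach (m : ℕ → ℕ → ℕ) (G : SimpleGraph (Fin n)) (Is It A : Finset (Fin n)) : Prop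
    extends HasInput m G Is It where
  clique : ∀ u : Fin n, Truth (m 3 u) ↔ u ∈ A
  reach : ∀ u v : Fin n, Truth (m 5 (u * n + v)) ↔ (crossGraph G A).Reachable u v

theorem HasReach.congr {m m' : ℕ → ℕ → ℕ} (h : HasReach m G Is It A) (h' : ∀ a < 6, m' a = m a) :
    HasReach m' G Is It A := by
  refine ⟨h.toHasInput.congr fun a ha => h' a (by omega), ?_, ?_⟩
  · rw [h' 3 (by decide)]; exact h.clique
  · rw [h' 5 (by decide)]; exact h.reach

theorem hasInput_instanceInput (G : SimpleGraph (Fin n)) (Is It : Finset (Fin n)) :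
    HasInput (instanceInput G Is It).arr G Is It := by
  classical
  refine ⟨fun u v => ?_, fun u => ?_, fun u => ?_⟩
  · have : (∃ u' v' : Fin n, u.val * n + v.val = u'.val * n + v'.val ∧ G.Adj u' v') ↔
        G.Adj u v := by
      constructor
      · rintro ⟨u', v', h, h'⟩
        obtain ⟨h1, h2⟩ := (index_inj v.isLt v'.isLt).1 h
        rwa [Fin.ext h1, Fin.ext h2]
      · exact fun h => ⟨u, v, rfl, h⟩
    simp [instanceInput, this, Truth]
  · simp [instanceInput, Truth, ← Fin.ext_iff]
  · simp [instanceInput, Truth, ← Fin.ext_iff]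

theorem eval_degTerm (h : HasInput s.arr G Is It) (h0 : s.reg 0 = n) {x : ℕ} (hx : x < 8)
    {u : Fin n} (hu : s.reg x = u) : (degTerm x).eval s = deg G u := by
  have h8 : x ≠ 8 := by omega
  have h9 : x ≠ 9 := by omega
  rw [degTerm, eval_count h0, deg]
  congr 1
  ext v
  simp [eval_cell h9, h8, h0, hu, h.adj]

theorem truth_degSetTerm (h : HasInput s.arr G Is It) (h0 : s.reg 0 = n) {d x y : ℕ} (hx : x < 8)
    {u v : Fin n} (hu : s.reg x = u) (hv : s.reg y = v) :
    Truth ((degSetTerm d y x).eval s) ↔ u ∈ degSet G (s.reg d) v := by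
  simp [degSetTerm, degSet, eval_degTerm h h0 hx hu, hu, hv, Fin.ext_iff]

theorem truth_splitTerm (h : HasInput s.arr G Is It) (h0 : s.reg 0 = n) {v : Fin n}
    (hv : s.reg 2 = v) :
    Truth (splitTerm.eval s) ↔ IsSplitSet G (degSet G (s.reg 1) v) := by
  have hmem : ∀ i j : Fin n, ∀ x, x = 3 ∨ x = 4 →
      (Truth ((degSetTerm 1 2 x).eval ((s.setReg 3 i).setReg 4 j)) ↔
        (if x = 3 then i else j) ∈ degSet G (s.reg 1) v) := by
    rintro i j x (rfl | rfl)
    · rw [truth_degSetTerm (u := i) (v := v) (by exact h) (by simpa using h0) (by decide) (by simp)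
        (by simpa using hv)]
      simp
    · rw [truth_degSetTerm (u := j) (v := v) (by exact h) (by simpa using h0) (by decide) (by simp)
        (by simpa using hv)]
      simp
  have h3 : ∀ i : Fin n, (s.setReg 3 i).reg 0 = n := fun i => by simpa using h0
  simp only [splitTerm, truth_all h0, truth_all (h3 _), truth_and, truth_imp, truth_or, truth_not,
    truth_eq, hmem _ _ 3 (Or.inl rfl), hmem _ _ 4 (Or.inr rfl)]
  simp only [eval_cell (show 3 ≠ 9 by decide), State.setReg_arr, eval_reg, State.setReg_reg]
  simp only [if_true, show (3 : ℕ) ≠ 4 by decide, show (4 : ℕ) ≠ 3 by decide, if_false, h0, h.adj,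
    show (0 : ℕ) ≠ 4 by decide, show (0 : ℕ) ≠ 3 by decide, ← Fin.ext_iff]
  constructor
  · intro H
    exact ⟨fun i hi j hj hij => ((H i j).1 ⟨hi, hj⟩).resolve_left hij,
      fun i hi j hj _ => (H i j).2 ⟨hi, hj⟩⟩
  · rintro ⟨hA, hB⟩ i j
    exact ⟨fun hij => or_iff_not_imp_left.2 fun hne => hA hij.1 hij.2 hne,
      fun hij hadj => hB hij.1 hij.2 hadj.ne hadj⟩

/-- The lexicographically least pair singles out one split set. -/
theorem exists_isSplitSet_table (hG : G.IsSplit) :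
    ∃ A, IsSplitSet G A ∧ ∀ u : Fin n, u ∈ A ↔ ∃ d v : Fin n, IsSplitSet G (degSet G d v) ∧
      (∀ d' v' : Fin n, IsSplitSet G (degSet G d' v') → d.val * n + v ≤ d'.val * n + v') ∧
      u ∈ degSet G d v := by
  rcases Nat.eq_zero_or_pos n with rfl | hn
  · exact ⟨∅, ⟨by simp, fun i => i.elim0⟩, fun u => u.elim0⟩
  have : Nonempty (Fin n) := ⟨⟨0, hn⟩⟩
  obtain ⟨d, hd, v, hdv⟩ := exists_isSplitSet_degSet hG
  rw [Fintype.card_fin] at hd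
  classical
  obtain ⟨⟨d, v⟩, hdv, hmin⟩ := exists_min_image
    ({p | IsSplitSet G (degSet G p.1 p.2)} : Finset (Fin n × Fin n)) (fun p => p.1.val * n + p.2)
    ⟨(⟨d, hd⟩, v), by simpa using hdv⟩
  simp only [mem_filter, mem_univ, true_and, Prod.forall] at hdv hmin
  refine ⟨degSet G d v, hdv, fun u => ⟨fun hu => ⟨d, v, hdv, hmin, hu⟩, ?_⟩⟩
  rintro ⟨d', v', hdv', hmin', hu⟩
  obtain ⟨h1, h2⟩ := (index_inj v.isLt v'.isLt).1 ((hmin d' v' hdv').antisymm (hmin' d v hdv))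
  rwa [h1, Fin.ext h2]

theorem truth_cliqueTerm (h : HasInput s.arr G Is It) (h0 : s.reg 0 = n)
    (h9 : ∀ d v : Fin n, Truth (s.arr 9 (d * n + v)) ↔ IsSplitSet G (degSet G d v)) {u : Fin n}
    (hu : s.reg 1 = u) :
    Truth (cliqueTerm.eval s) ↔ ∃ d v : Fin n, IsSplitSet G (degSet G d v) ∧
      (∀ d' v' : Fin n, IsSplitSet G (degSet G d' v') → d.val * n + v ≤ d'.val * n + v') ∧
      u ∈ degSet G d v := by
  have h3 : ∀ i : Fin n, (s.setReg 3 i).reg 0 = n := fun i => by simpa using h0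
  have h4 : ∀ i j : Fin n, ((s.setReg 3 i).setReg 4 j).reg 0 = n := fun i j => by simpa using h0
  have h5 : ∀ i j k : Fin n, (((s.setReg 3 i).setReg 4 j).setReg 5 k).reg 0 = n :=
    fun i j k => by simpa using h0
  rw [cliqueTerm, truth_ex h0]
  refine exists_congr fun d => ?_
  rw [truth_ex (h3 d)]
  refine exists_congr fun v => ?_
  rw [truth_and, truth_and, truth_all (h4 d v), truth_degSetTerm (u := u) (v := v) (by exact h)
    (h4 d v) (by decide) (by simpa using hu) (by simp), eval_cell (by decide)]
  simp [truth_all (h5 _ _ _), eval_cell, eval_index, h0, h9]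

section Reach

variable (h : HasReach s.arr G Is It A) (h0 : s.reg 0 = n)

include h h0

theorem truth_frozenTerm {x : ℕ} (hx : x < 8) {u : Fin n} (hu : s.reg x = u) :
    Truth ((frozenTerm x).eval s) ↔ u ∈ frozen G A := by
  have h8 : x ≠ 8 := by omega
  have h9 : x ≠ 9 := by omega
  simp [frozenTerm, truth_ex h0, eval_cell h9, h8, h0, hu, h.adj, h.clique]

theorem eval_movableCard : movableCard.eval s = #(movable G A) := by
  rw [movableCard, eval_count h0]
  congr 1
  ext v
  have h7 : (s.setReg 7 v).reg 0 = n := by simpa using h0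
  simp [truth_ex h7, eval_cell, h0, h.adj, h.clique]

theorem eval_tokensCard {a : ℕ} {X : Finset (Fin n)} (ha : ∀ u : Fin n, Truth (s.arr a u) ↔ u ∈ X) :
    (tokensCard a).eval s = #(X \ frozen G A) := by
  rw [tokensCard, eval_count h0]
  congr 1
  ext v
  have := truth_frozenTerm (s := s.setReg 7 v) (by exact h) (by simpa using h0)
    (show 7 < 8 by decide) (u := v) (by simp)
  simp only [mem_filter, mem_univ, true_and, truth_and, truth_not, this, mem_sdiff]
  simp [ha]

theorem eval_outerNbrsCard {x : ℕ} (hx : x < 7) {u : Fin n} (hu : s.reg x = u) :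
    (outerNbrsCard x).eval s = #(outerNbrs G A u) := by
  have h7 : x ≠ 7 := by omega
  have h9 : x ≠ 9 := by omega
  rw [outerNbrsCard, eval_count h0]
  congr 1
  ext v
  simp [eval_cell h9, h7, h0, hu, h.adj, h.clique]

theorem eval_outerCompCard {x : ℕ} (hx : x < 7) {u : Fin n} (hu : s.reg x = u) :
    (outerCompCard x).eval s = #(outerComp G A u) := by
  have h7 : x ≠ 7 := by omega
  have h9 : x ≠ 9 := by omega
  rw [outerCompCard, eval_count h0]
  congr 1
  ext v
  simp [eval_cell h9, h7, h0, hu, h.reach, h.clique]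

theorem eval_tokensCompCard {a : ℕ} {X : Finset (Fin n)}
    (ha : ∀ u : Fin n, Truth (s.arr a u) ↔ u ∈ X) {x : ℕ} (hx : x < 7) {u : Fin n}
    (hu : s.reg x = u) : (tokensCompCard a x).eval s = #(X ∩ outerComp G A u) := by
  have h7 : x ≠ 7 := by omega
  have h9 : x ≠ 9 := by omega
  rw [tokensCompCard, eval_count h0]
  congr 1
  ext v
  simp [eval_cell h9, h7, h0, hu, h.reach, h.clique, ha]

theorem truth_disjointTerm {a : ℕ} {X : Finset (Fin n)}
    (ha : ∀ u : Fin n, Truth (s.arr a u) ↔ u ∈ X) :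
    Truth ((disjointTerm a).eval s) ↔ Disjoint X A := by
  simp [disjointTerm, truth_all h0, ha, h.clique, Finset.disjoint_left]

theorem truth_entersTerm {a : ℕ} {X : Finset (Fin n)}
    (ha : ∀ u : Fin n, Truth (s.arr a u) ↔ u ∈ X) {x : ℕ} (hx : x < 7) {u : Fin n}
    (hu : s.reg x = u) : Truth ((entersTerm a x).eval s) ↔ Enters G A X u := by
  simp [entersTerm, Enters, truth_disjointTerm h h0 ha, eval_tokensCompCard h h0 ha hx hu,
    eval_outerNbrsCard h h0 hx hu, eval_outerCompCard h h0 hx hu, hu, ha, h.clique]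

theorem truth_linkedTerm {u v : Fin n} (hu : s.reg 1 = u) (hv : s.reg 2 = v) :
    Truth (linkedTerm.eval s) ↔ Linked G A #(Is \ frozen G A) u v := by
  simp [linkedTerm, roomTerm, Linked, eval_tokensCard h h0 h.source, eval_movableCard h h0,
    eval_outerNbrsCard h h0 (show 1 < 7 by decide) hu,
    eval_outerNbrsCard h h0 (show 2 < 7 by decide) hv, eval_cell, h0, hu, hv, h.clique, h.reach]

theorem truth_criterionTerm
    (h8 : ∀ u v : Fin n, Truth (s.arr 8 (u * n + v)) ↔
      Relation.ReflTransGen (Linked G A #(Is \ frozen G A)) u v) :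
    Truth (criterionTerm.eval s) ↔ Criterion G A Is It := by
  have hcount : ∀ {a : ℕ} {X : Finset (Fin n)}, (∀ u : Fin n, Truth (s.arr a u) ↔ u ∈ X) →
      (count 7 (mem a 7)).eval s = #X := by
    intro a X ha
    rw [eval_count h0]
    congr 1
    ext v
    simp [ha]
  have h6 : ∀ i : Fin n, (s.setReg 6 i).reg 0 = n := fun i => by simpa using h0
  have h1 : ∀ i : Fin n, (s.setReg 1 i).reg 0 = n := fun i => by simpa using h0
  have h12 : ∀ i j : Fin n, ((s.setReg 1 i).setReg 2 j).reg 0 = n := fun i j => by simpa using h0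
  rw [criterionTerm, Criterion, truth_and, truth_and, truth_or, truth_and, truth_and, truth_eq,
    hcount h.source, hcount h.target, truth_disjointTerm h h0 h.source,
    truth_disjointTerm h h0 h.target, truth_all h0, truth_all h0, truth_ex h0]
  refine and_congr Iff.rfl (and_congr ?_ (or_congr (and_congr Iff.rfl (and_congr Iff.rfl
    (forall_congr' fun u => ?_))) (exists_congr fun a => ?_)))
  · have := fun v : Fin n => truth_frozenTerm (s := s.setReg 6 v) (by exact h) (h6 v)
      (show 6 < 8 by decide) (u := v) (by simp)
    simp only [truth_imp, truth_and, this]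
    simp only [eval_mem, State.setReg_arr, State.setReg_reg, if_true, h.source, h.target]
    constructor
    · intro H
      ext v
      have := H v
      simp only [mem_inter]
      tauto
    · intro H v hv
      have := Finset.ext_iff.1 H v
      simp only [mem_inter] at this
      tauto
  · rw [truth_eq, eval_tokensCompCard (s := s.setReg 6 u) (by exact h) (h6 u) (by exact h.source)
      (by decide) (u := u) (by simp), eval_tokensCompCard (s := s.setReg 6 u) (by exact h) (h6 u)
      (by exact h.target) (by decide) (u := u) (by simp)]
  · rw [truth_ex (h1 a)]
    refine exists_congr fun b => ?_
    rw [truth_and, truth_and,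
      truth_entersTerm (s := (s.setReg 1 a).setReg 2 b) (by exact h) (h12 a b) (by exact h.source)
        (by decide) (u := a) (by simp),
      truth_entersTerm (s := (s.setReg 1 a).setReg 2 b) (by exact h) (h12 a b) (by exact h.target)
        (by decide) (u := b) (by simp), eval_cell (by decide)]
    simp [h0, h8]

end Reach

theorem tables_spec (hG : G.IsSplit) (h : HasInput s.arr G Is It) (h0 : s.reg 0 = n) :
    (tables.run s).reg 0 = n ∧ ∃ A, IsSplitSet G A ∧ HasReach (tables.run s).arr G Is It A ∧
      ∀ u v : Fin n, Truth ((tables.run s).arr 8 (u * n + v)) ↔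
        Relation.ReflTransGen (Linked G A #(Is \ frozen G A)) u v := by
  obtain ⟨A, hA, hAmem⟩ := exists_isSplitSet_table hG
  simp only [tables, Command.run.eq_2]
  obtain ⟨z1, f1, t1⟩ := tabulateRel_spec (n := n) h0 (a := 9) (t := splitTerm)
    (r := fun d v => IsSplitSet G (degSet G d v)) (fun s' d v h0' hf hd hv => by
      rw [truth_splitTerm (h.congr fun a ha => hf a (by omega)) h0' hv, hd])
  set s1 := (tabulateRel 9 splitTerm).run s
  obtain ⟨z2, f2, t2⟩ := tabulateSet_spec (n := n) z1 (a := 3) (t := cliqueTerm)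
    (p := fun u => u ∈ A) (fun s' u h0' hf hu => by
      rw [hAmem, truth_cliqueTerm (h.congr fun a ha => (hf a (by omega)).trans (f1 a (by omega)))
        h0' (by rw [hf 9 (by decide)]; exact t1) hu])
  set s2 := (tabulateSet 3 cliqueTerm).run s1
  have i2 : HasInput s2.arr G Is It :=
    h.congr fun a ha => (f2 a (by omega)).trans (f1 a (by omega))
  obtain ⟨z3, f3, t3⟩ := tabulateRel_spec (n := n) z2 (a := 4) (t := crossTerm)
    (r := (crossGraph G A).Adj) (fun s' u v h0' hf hu hv => by
      simp [crossTerm, crossGraph, eval_cell, h0', hu, hv, hf 0, hf 3, i2.adj, t2])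
  set s3 := (tabulateRel 4 crossTerm).run s2
  obtain ⟨z4, f4, t4⟩ := closure_spec z3 (e := 4) (r := 5) (b := 6) (by decide) (by decide)
    (by decide) t3
  set s4 := (closure 4 5 6).run s3
  have i4 : HasReach s4.arr G Is It A := by
    refine ⟨i2.congr fun a ha => (f4 a (by omega) (by omega)).trans (f3 a (by omega)), ?_, ?_⟩
    · rw [f4 3 (by decide) (by decide), f3 3 (by decide)]
      exact t2
    · intro u v
      rw [t4, SimpleGraph.reachable_iff_reflTransGen]
  obtain ⟨z5, f5, t5⟩ := tabulateRel_spec (n := n) z4 (a := 7) (t := linkedTerm)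
    (r := Linked G A #(Is \ frozen G A)) (fun s' u v h0' hf hu hv =>
      truth_linkedTerm (i4.congr fun a ha => hf a (by omega)) h0' hu hv)
  set s5 := (tabulateRel 7 linkedTerm).run s4
  obtain ⟨z6, f6, t6⟩ := closure_spec z5 (e := 7) (r := 8) (b := 6) (by decide) (by decide)
    (by decide) t5
  exact ⟨z6, A, hA, i4.congr fun a ha => (f6 a (by omega) (by omega)).trans (f5 a (by omega)), t6⟩

theorem bounded_tables : tables.Bounded 10 := by
  simp [tables, Command.closure, tabulateRel, tabulateSet, Command.Bounded, CountTerm.Bounded, splitTerm,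
    cliqueTerm, crossTerm, linkedTerm, roomTerm, frozenTerm, movableCard, tokensCard, outerNbrsCard,
    degSetTerm, degTerm, CountTerm.not, CountTerm.and, CountTerm.or, imp, lt, le, CountTerm.eq, ex,
    all, count, index, cell, CountTerm.mem]

theorem bounded_criterionTerm : (not (not criterionTerm)).Bounded 10 := by
  simp [criterionTerm, entersTerm, disjointTerm, tokensCompCard, outerCompCard, CountTerm.Bounded,
    frozenTerm, outerNbrsCard, CountTerm.not, CountTerm.and, CountTerm.or, imp, lt, le,
    CountTerm.eq, ex, all, count, index, cell, CountTerm.mem]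

end SplitReconf

theorem theorem2 :
    ∃ (P : RAM.Program) (f : Polynomial ℕ),
      ∀ (n : ℕ) (G : SimpleGraph (Fin n)), G.IsSplit →
        ∀ Is It : Finset (Fin n),
          G.IsIndepSet (Is : Set (Fin n)) → G.IsIndepSet (It : Set (Fin n)) →
          ∃ (t : ℕ) (s : RAM.State),
            RAM.Runs P (instanceInput G Is It) t s ∧ t ≤ f.eval n ∧
              (Reconfigurable G 2 Is It → s.reg 0 = 1) ∧
              (¬ Reconfigurable G 2 Is It → s.reg 0 = 0) := by
  obtain ⟨f, hf⟩ := SplitReconf.tables.exists_runs_compile (K := 10)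
    (by decide) SplitReconf.bounded_tables 10 le_rfl
  obtain ⟨g, hg⟩ := RAM.CountTerm.exists_runs_compile _ 10 (by decide)
    SplitReconf.bounded_criterionTerm
  refine ⟨SplitReconf.decider, f + g + Polynomial.C 2, fun n G hG Is It hIs hIt => ?_⟩
  have h0 : (instanceInput G Is It).reg 0 = n := by simp [instanceInput]
  obtain ⟨z, A, ⟨hA, hB⟩, hr, h8⟩ :=
    SplitReconf.tables_spec hG (SplitReconf.hasInput_instanceInput G Is It) h0
  obtain ⟨τ, s, hrun, hτ, hs, -⟩ := hf _ _ (RAM.State.Agree.refl 10 (instanceInput G Is It))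
  obtain ⟨τ', s', hrun', hτ', -, hv⟩ := hg s
  have hs0 : s.reg 0 = n := (hs.2 0 (by decide)).trans z
  have htruth : RAM.Truth (SplitReconf.criterionTerm.eval s) ↔ Reconfigurable G 2 Is It := by
    rw [SplitReconf.reconfigurable_iff_criterion hA hB hIs hIt]
    rw [← hs.1] at hr h8
    exact SplitReconf.truth_criterionTerm hr hs0 h8
  refine ⟨_, _, hrun.seq (hrun'.seq (RAM.Runs.assign _ _ _)), ?_, fun h => ?_, fun h => ?_⟩
  · rw [h0] at hτ
    rw [hs0] at hτ'
    simp only [RAM.Expr.cost, Polynomial.eval_add, Polynomial.eval_C]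
    omega
  · rw [← htruth, RAM.Truth] at h
    simp only [RAM.State.setReg_reg, if_true, RAM.Expr.eval, hv, RAM.CountTerm.not, RAM.CountTerm.eval]
    omega
  · rw [← htruth, RAM.Truth] at h
    simp only [RAM.State.setReg_reg, if_true, RAM.Expr.eval, hv, RAM.CountTerm.not, RAM.CountTerm.eval]
    omega
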